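/- Let $\lambda$ be a partition of $n$ and let $d$ be the number of dots on the main diagonal of its Ferrers graph. For $1\le i\le d$ let $x_i$ be the number of dots in row $i$ to the right of the $i$-th diagonal dot and $y_i$ the number of dots in column $i$ below it. The array $\begin{pmatrix} x_1 & \cdots & x_d\\ y_1 & \cdots & y_d\end{pmatrix}$ is the Frobenius symbol of $\lambda$, and we say that $\lambda$ has exactly $d$ columns (the $i$-th successive rank of $\lambda$ is $x_i-y_i$). A column is positive if $x_i-y_i\ge 1$ and negative if $x_i-y_i\le 0$; two columns have the same parity if both are positive or both are negative. The parity blocks of $\lambda$ are the maximal sets of contiguous columns having the same parity; a block is positive (negative) if its columns are positive (negative). For positive integers $d\ge m$, let $a^+_m(n;d)$ and $a^-_m(n;d)$ be the numbers of partitions of $n$ with exactly $d$ columns and exactly $m$ parity blocks, the last of which is positive, respectively negative. Write $(a;q)_n=\prod_{i=0}^{n-1}(1-aq^i)$ and $\begin{bmatrix} n\\ k\end{bmatrix}_q=\frac{(q;q)_n}{(q;q)_k(q;q)_{n-k}}$ for $n\ge k\ge 0$ (and $0$ otherwise). **Theorem.** For all integers $d\ge m\ge 1$, as formal power series in $q$,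 $$\sum_{n\ge 0} a^+_m(n;d)\,q^n=\frac{q^{d^2+d+\binom m2}}{(q;q)_{2d}}\,\frac{1-q^m}{1-q^d}\begin{bmatrix} 2d\\ d+m\end{bmatrix}_q$$ and $$\sum_{n\ge 0} a^-_m(n;d)\,q^n=\frac{q^{d^2+\binom m2}}{(q;q)_{2d}}\,\frac{1-q^m}{1-q^d}\begin{bmatrix} 2d\\ d+m\end{bmatrix}_q .$$ -/

import Mathlib

namespace ParityBlocks

/-- The number of dots in row `i` (counted from `0`, largest part first) of the Ferrers graph of
`p`; it is `0` if `p` has at most `i` parts. -/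
def rowLength {n : ℕ} (p : n.Partition) (i : ℕ) : ℕ :=
  (p.parts.sort (· ≥ ·)).getD i 0

/-- The number of dots in column `j` (counted from `0`) of the Ferrers graph of `p`, that is, the
number of parts greater than `j`. -/
def colLength {n : ℕ} (p : n.Partition) (j : ℕ) : ℕ :=
  p.parts.countP (fun k => j < k)

/-- The number of dots `(i, i)` on the main diagonal of the Ferrers graph of `p`. The range loses
nothing: if `(i, i)` is a dot then `i < n`. -/
def diagLength {n : ℕ} (p : n.Partition) : ℕ :=
  ((Finset.range n).filter (fun i => i < rowLength p i)).card

/-- The Frobenius symbol of `p`, as the list of its columns `(x_i, y_i)`: `x_i` is the number of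
dots to the right of the `i`-th diagonal dot and `y_i` the number of dots below it. For
`i < diagLength p` both row `i` and column `i` have more than `i` dots, so that the subtractions
are not truncated. -/
def frobenius {n : ℕ} (p : n.Partition) : List (ℕ × ℕ) :=
  (List.range (diagLength p)).map
    (fun i => (rowLength p i - (i + 1), colLength p i - (i + 1)))

/-- A column `(x, y)` is positive if `x - y ≥ 1`. -/
abbrev IsPositive (c : ℕ × ℕ) : Prop := (c.1 : ℤ) - (c.2 : ℤ) ≥ 1

/-- A column `(x, y)` is negative if `x - y ≤ 0`. -/
abbrev IsNegative (c : ℕ × ℕ) : Prop := (c.1 : ℤ) - (c.2 : ℤ) ≤ 0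

/-- Two columns have the same parity if both are positive or both are negative. -/
abbrev SameParity (c c' : ℕ × ℕ) : Prop :=
  (IsPositive c ∧ IsPositive c') ∨ (IsNegative c ∧ IsNegative c')

/-- The parity blocks of `p`, from left to right: the maximal runs of contiguous columns of the
Frobenius symbol that have the same parity. -/
def parityBlocks {n : ℕ} (p : n.Partition) : List (List (ℕ × ℕ)) :=
  (frobenius p).splitBy (fun c c' => decide (SameParity c c'))

/-- The last parity block exists and consists of positive columns. -/
abbrev LastBlockPositive {n : ℕ} (p : n.Partition) : Prop :=
  ∃ B ∈ (parityBlocks p).getLast?, ∀ c ∈ B, IsPositive c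

/-- The last parity block exists and consists of negative columns. -/
abbrev LastBlockNegative {n : ℕ} (p : n.Partition) : Prop :=
  ∃ B ∈ (parityBlocks p).getLast?, ∀ c ∈ B, IsNegative c

/-- `a⁺_m(n; d)`: the number of partitions of `n` with exactly `d` columns and `m` parity blocks,
the last of which is positive. -/
def aPos (m d n : ℕ) : ℕ :=
  ((Finset.univ : Finset n.Partition).filter (fun p =>
    (frobenius p).length = d ∧ (parityBlocks p).length = m ∧ LastBlockPositive p)).card

/-- `a⁻_m(n; d)`: the number of partitions of `n` with exactly `d` columns and `m` parity blocks,
the last of which is negative. -/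
def aNeg (m d n : ℕ) : ℕ :=
  ((Finset.univ : Finset n.Partition).filter (fun p =>
    (frobenius p).length = d ∧ (parityBlocks p).length = m ∧ LastBlockNegative p)).card

/-- `(a; q)_n = (1 - a)(1 - a q) ⋯ (1 - a q ^ (n - 1))`. -/
def qPochhammer {R : Type*} [CommRing R] (a q : R) (n : ℕ) : R :=
  ∏ i ∈ Finset.range n, (1 - a * q ^ i)

/-- The `q`-binomial coefficient `(q; q)_n / ((q; q)_k (q; q)_{n - k})`, and `0` unless `k ≤ n`,
with `q = X` in the ring of formal power series. The inverse is a true one: the series inverted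
has constant term `1`. -/
noncomputable def qBinomial (n k : ℕ) : PowerSeries ℚ :=
  if k ≤ n then
    qPochhammer PowerSeries.X PowerSeries.X n *
      (qPochhammer PowerSeries.X PowerSeries.X k *
        qPochhammer PowerSeries.X PowerSeries.X (n - k))⁻¹
  else 0

end ParityBlocks

namespace ParityBlocks

open PowerSeries

/-! A partition with `d` diagonal dots amounts to two strictly decreasing lists of naturals of
length `d`, of total `n - d`, and its parity blocks are the runs in the list of column signs. To get
a recursion, the two rows may have different lengths `a` and `b`, a missing entry counting as minus
infinity. A strictly decreasing list is a list raised by one, possibly followed by a zero, so every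
pair arises from a smaller or equal one by one of four maps (`exists_shift`). A zero appended to the
strictly shorter row changes no sign, because ties count as negative in the first row and raised
entries beat zero in the second; otherwise the zeros open one new last column of known sign. This
gives a linear recursion for the generating functions (`genFun_pairsWith_eq`). The recursion closes
if one counts pairs with more than `k` runs after a further column has been added, positive for `b ≤
a` (`upGen`) and negative for `a ≤ b` (`downGen`): off the diagonal the further column merges with
the overhang, and at `a = b` the two families feed each other with `k` lowered by one. "More than
`k`" is preferred to "exactly" because these series are single products, `upForm` and `downForm`,
which satisfy the same recursions; induction on `a + b` identifies them (`upGen_and_downGen_eq`).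
One more step of the recursion fixes the last sign, and the difference between `k` and `k + 1`
isolates `k + 1` runs. The factor `(1 - q^m) / (1 - q^d)` comes from this difference, whose
numerator is `(1 - q^m)(1 + q^d)`, over `1 - q^(2d)`. -/

/-! ### Column signs and their runs -/

/-- The signs of the columns of an array with top row `xs` and bottom row `ys`, `true` standing for
a positive column; a missing entry counts as smaller than every number. -/
def signs : List ℕ → List ℕ → List Bool
  | [], [] => []
  | _ :: xs, [] => true :: signs xs []
  | [], _ :: ys => false :: signs [] ys
  | x :: xs, y :: ys => decide (y < x) :: signs xs ys

/-- The number of runs of a list of signs. -/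
def runs : List Bool → ℕ
  | [] => 0
  | [_] => 1
  | a :: b :: l => (if a = b then 0 else 1) + runs (b :: l)

theorem runs_pos (l : List Bool) (a : Bool) : 0 < runs (l ++ [a]) := by
  induction l with
  | nil => simp [runs]
  | cons b l ih =>
    cases l with
    | nil => simp [runs]
    | cons c l => simp only [List.cons_append, runs] at ih ⊢; omega

theorem runs_append_same (l : List Bool) (a : Bool) :
    runs (l ++ [a] ++ [a]) = runs (l ++ [a]) := by
  induction l with
  | nil => simp [runs]
  | cons b l ih =>
    cases l with
    | nil => simp [runs]
    | cons c l => simp only [List.cons_append, runs] at ih ⊢; omega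

theorem runs_append_ne (l : List Bool) {a b : Bool} (h : a ≠ b) :
    runs (l ++ [a] ++ [b]) = runs (l ++ [a]) + 1 := by
  induction l with
  | nil => simp [runs, h]
  | cons c l ih =>
    cases l with
    | nil => simp [runs, h]
    | cons c' l => simp only [List.cons_append, runs] at ih ⊢; omega

theorem signs_map_succ (xs ys : List ℕ) :
    signs (xs.map Nat.succ) (ys.map Nat.succ) = signs xs ys := by
  fun_induction signs xs ys <;> simp_all [signs]

theorem signs_concat_left {xs ys : List ℕ} (h : ys.length ≤ xs.length) (a : ℕ) :
    signs (xs ++ [a]) ys = signs xs ys ++ [true] := by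
  fun_induction signs xs ys <;> simp_all [signs]

theorem signs_concat_right {xs ys : List ℕ} (h : xs.length ≤ ys.length) (a : ℕ) :
    signs xs (ys ++ [a]) = signs xs ys ++ [false] := by
  fun_induction signs xs ys <;> simp_all [signs]

/-- Zero exceeds no entry of the second row, so the new zero gives the same negative sign as the
missing entry it replaces. -/
theorem signs_concat_zero_left {xs ys : List ℕ} (h : xs.length < ys.length) :
    signs (xs ++ [0]) ys = signs xs ys := by
  fun_induction signs xs ys <;> simp_all [signs]

/-- Every raised entry beats zero just as it beats a missing entry; without the raise, a tie `0, 0`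
would turn a positive column negative. -/
theorem signs_concat_zero_right {xs ys : List ℕ} (h : ys.length < xs.length) :
    signs (xs.map Nat.succ) (ys ++ [0]) = signs (xs.map Nat.succ) ys := by
  fun_induction signs xs ys <;> simp_all [signs]

theorem exists_signs_eq_concat_true {xs ys : List ℕ} (h : ys.length < xs.length) :
    ∃ s, signs xs ys = s ++ [true] := by
  rcases List.eq_nil_or_concat' xs with rfl | ⟨xs, a, rfl⟩
  · simp at h
  · exact ⟨_, signs_concat_left (by simpa [Nat.lt_succ_iff] using h) a⟩

theorem exists_signs_eq_concat_false {xs ys : List ℕ} (h : xs.length < ys.length) :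
    ∃ s, signs xs ys = s ++ [false] := by
  rcases List.eq_nil_or_concat' ys with rfl | ⟨ys, a, rfl⟩
  · simp at h
  · exact ⟨_, signs_concat_right (by simpa [Nat.lt_succ_iff] using h) a⟩

theorem signs_eq_map_zip {xs ys : List ℕ} (h : xs.length = ys.length) :
    signs xs ys = (xs.zip ys).map (fun c => decide (c.2 < c.1)) := by
  fun_induction signs xs ys <;> simp_all [signs]

/-! ### Strictly decreasing lists: raising and appending zero -/

/-- In a strictly decreasing list zero can occur only once, at the end. -/
theorem exists_map_succ {xs : List ℕ} (h : xs.Pairwise (· > ·)) :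
    ∃ xs' : List ℕ, xs'.Pairwise (· > ·) ∧
      (xs = xs'.map Nat.succ ∨ xs = xs'.map Nat.succ ++ [0]) := by
  induction xs with
  | nil => exact ⟨[], by simp⟩
  | cons x xs ih =>
    obtain ⟨xs', h1, h2⟩ := ih h.of_cons
    cases x with
    | zero =>
      cases xs with
      | nil => exact ⟨[], by simp⟩
      | cons y xs => exact absurd ((List.pairwise_cons.1 h).1 y (by simp)) (by simp)
    | succ x =>
      refine ⟨x :: xs', ?_, ?_⟩
      · refine List.pairwise_cons.2 ⟨fun a ha => ?_, h1⟩
        have := (List.pairwise_cons.1 h).1 (a + 1) (by rcases h2 with rfl | rfl <;> simp [ha])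
        omega
      · rcases h2 with rfl | rfl <;> simp

theorem pairwise_map_succ {xs : List ℕ} :
    (xs.map Nat.succ).Pairwise (· > ·) ↔ xs.Pairwise (· > ·) := by
  simp [List.pairwise_map]

theorem pairwise_map_succ_concat {xs : List ℕ} :
    (xs.map Nat.succ ++ [0]).Pairwise (· > ·) ↔ xs.Pairwise (· > ·) := by
  simp [List.pairwise_append, List.pairwise_map]

theorem map_succ_ne_concat_zero (xs xs' : List ℕ) :
    xs.map Nat.succ ≠ xs'.map Nat.succ ++ [0] := by
  intro h
  have : 0 ∈ xs.map Nat.succ := by rw [h]; simp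
  simp at this

theorem map_succ_injective : Function.Injective (List.map Nat.succ) :=
  List.map_injective_iff.2 Nat.succ_injective

theorem sum_map_succ (xs : List ℕ) : (xs.map Nat.succ).sum = xs.sum + xs.length := by
  induction xs with
  | nil => rfl
  | cons x xs ih => simp only [List.map_cons, List.sum_cons, List.length_cons, ih]; omega

/-! ### Blocks of `List.splitBy` as runs of a Boolean -/

theorem length_splitBy_loop {α : Type*} (r : α → α → Bool) (f : α → Bool)
    (hr : ∀ a b, r a b = decide (f a = f b)) (l : List α) (a : α) (g : List α)
    (gs : List (List α)) :
    (List.splitBy.loop r l a g gs).length = gs.length + runs ((a :: l).map f) := by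
  induction l generalizing a g gs with
  | nil => simp [List.splitBy.loop, runs]
  | cons b l ih =>
    by_cases h : f a = f b
    · have hab : r a b = true := by simp [hr, h]
      simp [List.splitBy.loop, hab, ih, runs, h]
    · have hab : r a b = false := by simp [hr, h]
      simp [List.splitBy.loop, hab, ih, runs, h]
      omega

theorem length_splitBy {α : Type*} (r : α → α → Bool) (f : α → Bool)
    (hr : ∀ a b, r a b = decide (f a = f b)) (l : List α) :
    (l.splitBy r).length = runs (l.map f) := by
  cases l with
  | nil => simp [runs]
  | cons a l => simpa [List.splitBy] using length_splitBy_loop r f hr l a [] []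

/-- In the loop, `a` is the latest element of the open block, `g` its earlier ones and `gs` the
closed blocks. By `hg` the open block has constant `f`, so its latest element speaks for all of it.
-/
theorem getLast_splitBy_loop {α : Type*} (r : α → α → Bool) (f : α → Bool)
    (hr : ∀ a b, r a b = decide (f a = f b)) (t : Bool) (l : List α) (a : α) (g : List α)
    (hg : ∀ b ∈ g, f b = f a) (gs : List (List α)) :
    (∃ B ∈ (List.splitBy.loop r l a g gs).getLast?, ∀ c ∈ B, f c = t) ↔
      ((a :: l).map f).getLast? = some t := by
  induction l generalizing a g gs with
  | nil =>
    simp only [List.splitBy.loop, List.getLast?_reverse, List.head?_cons, Option.mem_some_iff,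
      exists_eq_left', List.mem_reverse, List.forall_mem_cons, List.map_cons, List.map_nil,
      List.getLast?_singleton, Option.some.injEq, and_iff_left_iff_imp]
    exact fun h b hb => (hg b hb).trans h
  | cons b l ih =>
    by_cases h : f a = f b
    · have hab : r a b = true := by simp [hr, h]
      simp only [List.splitBy.loop, hab]
      rw [ih b (a :: g) (by simp_all)]
      simp [List.getLast?_cons_cons]
    · have hab : r a b = false := by simp [hr, h]
      simp only [List.splitBy.loop, hab]
      rw [ih b [] (by simp)]
      simp [List.getLast?_cons_cons]

theorem getLast_splitBy {α : Type*} (r : α → α → Bool) (f : α → Bool)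
    (hr : ∀ a b, r a b = decide (f a = f b)) (t : Bool) (l : List α) :
    (∃ B ∈ (l.splitBy r).getLast?, ∀ c ∈ B, f c = t) ↔ (l.map f).getLast? = some t := by
  cases l with
  | nil => simp
  | cons a l => exact getLast_splitBy_loop r f hr t l a [] (by simp) []

/-! ### Pairs of rows, their generating functions and the four maps -/

/-- The pairs of strictly decreasing lists of lengths `a` and `b`. -/
def pairs (a b : ℕ) : Set (List ℕ × List ℕ) :=
  {p | p.1.Pairwise (· > ·) ∧ p.2.Pairwise (· > ·) ∧ p.1.length = a ∧ p.2.length = b}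

/-- The pairs in `pairs a b` whose signs satisfy `Q`. -/
def pairsWith (a b : ℕ) (Q : List Bool → Prop) : Set (List ℕ × List ℕ) :=
  {p ∈ pairs a b | Q (signs p.1 p.2)}

/-- The generating function of a set of pairs of lists by the total sum of the entries. -/
noncomputable def genFun (A : Set (List ℕ × List ℕ)) : ℚ⟦X⟧ :=
  .mk fun n => ({p ∈ A | p.1.sum + p.2.sum = n}.ncard : ℚ)

/-- Raise all entries by one. -/
def shift (p : List ℕ × List ℕ) : List ℕ × List ℕ := (p.1.map Nat.succ, p.2.map Nat.succ)

/-- Raise all entries by one and append a zero to the first list. -/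
def shiftLeft (p : List ℕ × List ℕ) : List ℕ × List ℕ :=
  (p.1.map Nat.succ ++ [0], p.2.map Nat.succ)

/-- Raise all entries by one and append a zero to the second list. -/
def shiftRight (p : List ℕ × List ℕ) : List ℕ × List ℕ :=
  (p.1.map Nat.succ, p.2.map Nat.succ ++ [0])

/-- Raise all entries by one and append a zero to both lists. -/
def shiftBoth (p : List ℕ × List ℕ) : List ℕ × List ℕ :=
  (p.1.map Nat.succ ++ [0], p.2.map Nat.succ ++ [0])

theorem finite_bounded_lists (a n : ℕ) :
    {l : List ℕ | l.length = a ∧ ∀ x ∈ l, x ≤ n}.Finite := by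
  induction a with
  | zero =>
    refine (Set.finite_singleton []).subset fun l hl => ?_
    simpa using hl.1
  | succ a ih =>
    refine ((Set.finite_Iic n).image2 List.cons ih).subset fun l hl => ?_
    obtain ⟨h1, h2⟩ := hl
    cases l with
    | nil => simp at h1
    | cons x l => exact ⟨x, by simpa using h2 x, l, by simp_all, rfl⟩

/-- Entries are bounded by the total and lengths are fixed. Finiteness is what makes `Set.ncard`,
hence `genFun`, additive. -/
theorem finite_level {a b : ℕ} {A : Set (List ℕ × List ℕ)} (hA : A ⊆ pairs a b) (n : ℕ) :
    {p ∈ A | p.1.sum + p.2.sum = n}.Finite := by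
  refine ((finite_bounded_lists a n).prod (finite_bounded_lists b n)).subset ?_
  rintro ⟨xs, ys⟩ ⟨h, hn⟩
  obtain ⟨-, -, h1, h2⟩ := hA h
  refine ⟨⟨h1, fun x hx => ?_⟩, ⟨h2, fun x hx => ?_⟩⟩
  · have := List.le_sum_of_mem hx
    simp only at hn this ⊢; omega
  · have := List.le_sum_of_mem hx
    simp only at hn this ⊢; omega

theorem genFun_empty : genFun ∅ = 0 := by
  ext n
  simp [genFun]

theorem genFun_union {a b : ℕ} {A B : Set (List ℕ × List ℕ)} (hA : A ⊆ pairs a b)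
    (hB : B ⊆ pairs a b) (hAB : Disjoint A B) : genFun (A ∪ B) = genFun A + genFun B := by
  ext n
  simp only [genFun, coeff_mk, map_add]
  rw [← Nat.cast_add, ← Set.ncard_union_eq _ (finite_level hA n) (finite_level hB n)]
  · congr 2
    ext p
    simp only [Set.mem_ofPred_eq, Set.mem_union]
    tauto
  · exact hAB.mono (fun p hp => hp.1) (fun p hp => hp.1)

theorem genFun_image {f : List ℕ × List ℕ → List ℕ × List ℕ} (hf : f.Injective)
    {A : Set (List ℕ × List ℕ)} {c : ℕ}
    (hw : ∀ p ∈ A, (f p).1.sum + (f p).2.sum = p.1.sum + p.2.sum + c) :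
    genFun (f '' A) = X ^ c * genFun A := by
  ext n
  rw [coeff_X_pow_mul']
  simp only [genFun, coeff_mk]
  split_ifs with h
  · rw [← Set.ncard_image_of_injective {p ∈ A | p.1.sum + p.2.sum = n - c} hf]
    congr 2
    ext p
    simp only [Set.mem_ofPred_eq, Set.mem_image]
    constructor
    · rintro ⟨⟨q, hq, rfl⟩, h2⟩
      exact ⟨q, ⟨hq, by have := hw q hq; omega⟩, rfl⟩
    · rintro ⟨q, ⟨hq, h2⟩, rfl⟩
      exact ⟨⟨q, hq, rfl⟩, by have := hw q hq; omega⟩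
  · have : {p ∈ f '' A | p.1.sum + p.2.sum = n} = ∅ := by
      rw [Set.eq_empty_iff_forall_notMem]
      rintro p ⟨⟨q, hq, rfl⟩, h2⟩
      have := hw q hq
      omega
    rw [this]
    simp

theorem shift_injective : shift.Injective := by
  rintro ⟨x, y⟩ ⟨x', y'⟩ h
  simp only [shift, Prod.mk.injEq, map_succ_injective.eq_iff] at h
  simp [h]

theorem shiftLeft_injective : shiftLeft.Injective := by
  rintro ⟨x, y⟩ ⟨x', y'⟩ h
  simp only [shiftLeft, Prod.mk.injEq, map_succ_injective.eq_iff, List.append_cancel_right_eq] at h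
  simp [h]

theorem shiftRight_injective : shiftRight.Injective := by
  rintro ⟨x, y⟩ ⟨x', y'⟩ h
  simp only [shiftRight, Prod.mk.injEq, map_succ_injective.eq_iff, List.append_cancel_right_eq] at h
  simp [h]

theorem shiftBoth_injective : shiftBoth.Injective := by
  rintro ⟨x, y⟩ ⟨x', y'⟩ h
  simp only [shiftBoth, Prod.mk.injEq, map_succ_injective.eq_iff, List.append_cancel_right_eq] at h
  simp [h]

theorem disjoint_image {f g : List ℕ × List ℕ → List ℕ × List ℕ} (h : ∀ p q, f p ≠ g q)
    {A B : Set (List ℕ × List ℕ)} : Disjoint (f '' A) (g '' B) := by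
  rw [Set.disjoint_left]
  rintro _ ⟨p, -, rfl⟩ ⟨q, -, e⟩
  exact h p q e.symm

theorem shift_ne_shiftLeft (p q : List ℕ × List ℕ) : shift p ≠ shiftLeft q := fun h =>
  map_succ_ne_concat_zero _ _ (congrArg Prod.fst h)

theorem shift_ne_shiftRight (p q : List ℕ × List ℕ) : shift p ≠ shiftRight q := fun h =>
  map_succ_ne_concat_zero _ _ (congrArg Prod.snd h)

theorem shift_ne_shiftBoth (p q : List ℕ × List ℕ) : shift p ≠ shiftBoth q := fun h =>
  map_succ_ne_concat_zero _ _ (congrArg Prod.fst h)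

theorem shiftLeft_ne_shiftRight (p q : List ℕ × List ℕ) : shiftLeft p ≠ shiftRight q := fun h =>
  map_succ_ne_concat_zero _ _ (congrArg Prod.snd h)

theorem shiftLeft_ne_shiftBoth (p q : List ℕ × List ℕ) : shiftLeft p ≠ shiftBoth q := fun h =>
  map_succ_ne_concat_zero _ _ (congrArg Prod.snd h)

theorem shiftRight_ne_shiftBoth (p q : List ℕ × List ℕ) : shiftRight p ≠ shiftBoth q := fun h =>
  map_succ_ne_concat_zero _ _ (congrArg Prod.fst h)

theorem shift_mem {a b : ℕ} {p : List ℕ × List ℕ} : shift p ∈ pairs a b ↔ p ∈ pairs a b := by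
  simp only [pairs, Set.mem_ofPred_eq, shift, pairwise_map_succ, List.length_map]

theorem shiftLeft_mem {a b : ℕ} {p : List ℕ × List ℕ} :
    shiftLeft p ∈ pairs (a + 1) b ↔ p ∈ pairs a b := by
  simp only [pairs, Set.mem_ofPred_eq, shiftLeft, pairwise_map_succ, pairwise_map_succ_concat,
    List.length_map, List.length_append, List.length_singleton, Nat.add_right_cancel_iff]

theorem shiftRight_mem {a b : ℕ} {p : List ℕ × List ℕ} :
    shiftRight p ∈ pairs a (b + 1) ↔ p ∈ pairs a b := by
  simp only [pairs, Set.mem_ofPred_eq, shiftRight, pairwise_map_succ, pairwise_map_succ_concat,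
    List.length_map, List.length_append, List.length_singleton, Nat.add_right_cancel_iff]

theorem shiftBoth_mem {a b : ℕ} {p : List ℕ × List ℕ} :
    shiftBoth p ∈ pairs (a + 1) (b + 1) ↔ p ∈ pairs a b := by
  simp only [pairs, Set.mem_ofPred_eq, shiftBoth, pairwise_map_succ_concat,
    List.length_map, List.length_append, List.length_singleton, Nat.add_right_cancel_iff]

theorem shift_sum {a b : ℕ} {p : List ℕ × List ℕ} (hp : p ∈ pairs a b) :
    (shift p).1.sum + (shift p).2.sum = p.1.sum + p.2.sum + (a + b) := by
  obtain ⟨-, -, rfl, rfl⟩ := hp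
  simp only [shift, sum_map_succ]
  omega

theorem shiftLeft_sum {a b : ℕ} {p : List ℕ × List ℕ} (hp : p ∈ pairs a b) :
    (shiftLeft p).1.sum + (shiftLeft p).2.sum = p.1.sum + p.2.sum + (a + b) := by
  obtain ⟨-, -, rfl, rfl⟩ := hp
  simp only [shiftLeft, sum_map_succ, List.sum_append, List.sum_singleton]
  omega

theorem shiftRight_sum {a b : ℕ} {p : List ℕ × List ℕ} (hp : p ∈ pairs a b) :
    (shiftRight p).1.sum + (shiftRight p).2.sum = p.1.sum + p.2.sum + (a + b) := by
  obtain ⟨-, -, rfl, rfl⟩ := hp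
  simp only [shiftRight, sum_map_succ, List.sum_append, List.sum_singleton]
  omega

theorem shiftBoth_sum {a b : ℕ} {p : List ℕ × List ℕ} (hp : p ∈ pairs a b) :
    (shiftBoth p).1.sum + (shiftBoth p).2.sum = p.1.sum + p.2.sum + (a + b) := by
  obtain ⟨-, -, rfl, rfl⟩ := hp
  simp only [shiftBoth, sum_map_succ, List.sum_append, List.sum_singleton]
  omega

/-! ### The recursion by the smallest entries -/

theorem exists_shift {a b : ℕ} {p : List ℕ × List ℕ} (hp : p ∈ pairs a b) :
    ∃ q, p = shift q ∨ p = shiftLeft q ∨ p = shiftRight q ∨ p = shiftBoth q := by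
  obtain ⟨xs, ys⟩ := p
  obtain ⟨xs', -, hx⟩ := exists_map_succ hp.1
  obtain ⟨ys', -, hy⟩ := exists_map_succ hp.2.1
  refine ⟨(xs', ys'), ?_⟩
  simp only at hx hy
  rcases hx with rfl | rfl <;> rcases hy with rfl | rfl <;>
    simp only [shift, shiftLeft, shiftRight, shiftBoth, true_or, or_true]

theorem pairsWith_subset (a b : ℕ) (Q : List Bool → Prop) : pairsWith a b Q ⊆ pairs a b :=
  fun _ hp => hp.1

/-- The images of the four maps partition the pairs. `shift` preserves signs, so its term is the
same series times `X ^ (a + b + 2)` and moves to the left; each other map raises only the entries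
present before the zeros are appended, which gives the remaining exponents. -/
theorem genFun_pairsWith_eq (a b : ℕ) (Q Q₁ Q₂ Q₃ : List Bool → Prop)
    (h₁ : ∀ p ∈ pairs a (b + 1), Q (signs (shiftLeft p).1 (shiftLeft p).2) ↔ Q₁ (signs p.1 p.2))
    (h₂ : ∀ p ∈ pairs (a + 1) b, Q (signs (shiftRight p).1 (shiftRight p).2) ↔ Q₂ (signs p.1 p.2))
    (h₃ : ∀ p ∈ pairs a b, Q (signs (shiftBoth p).1 (shiftBoth p).2) ↔ Q₃ (signs p.1 p.2)) :
    (1 - X ^ (a + b + 2)) * genFun (pairsWith (a + 1) (b + 1) Q) =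
      X ^ (a + b + 1) * (genFun (pairsWith a (b + 1) Q₁) + genFun (pairsWith (a + 1) b Q₂)) +
      X ^ (a + b) * genFun (pairsWith a b Q₃) := by
  have hS : pairsWith (a + 1) (b + 1) Q =
      shift '' pairsWith (a + 1) (b + 1) Q ∪ (shiftLeft '' pairsWith a (b + 1) Q₁ ∪
        (shiftRight '' pairsWith (a + 1) b Q₂ ∪ shiftBoth '' pairsWith a b Q₃)) := by
    ext p
    constructor
    · intro hp
      obtain ⟨q, rfl | rfl | rfl | rfl⟩ := exists_shift hp.1
      · refine .inl ⟨q, ⟨shift_mem.1 hp.1, ?_⟩, rfl⟩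
        simpa only [shift, signs_map_succ] using hp.2
      · have hq := shiftLeft_mem.1 hp.1
        exact .inr (.inl ⟨q, ⟨hq, (h₁ q hq).1 hp.2⟩, rfl⟩)
      · have hq := shiftRight_mem.1 hp.1
        exact .inr (.inr (.inl ⟨q, ⟨hq, (h₂ q hq).1 hp.2⟩, rfl⟩))
      · have hq := shiftBoth_mem.1 hp.1
        exact .inr (.inr (.inr ⟨q, ⟨hq, (h₃ q hq).1 hp.2⟩, rfl⟩))
    · rintro (⟨q, hq, rfl⟩ | ⟨q, hq, rfl⟩ | ⟨q, hq, rfl⟩ | ⟨q, hq, rfl⟩)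
      · refine ⟨shift_mem.2 hq.1, ?_⟩
        simpa only [shift, signs_map_succ] using hq.2
      · exact ⟨shiftLeft_mem.2 hq.1, (h₁ q hq.1).2 hq.2⟩
      · exact ⟨shiftRight_mem.2 hq.1, (h₂ q hq.1).2 hq.2⟩
      · exact ⟨shiftBoth_mem.2 hq.1, (h₃ q hq.1).2 hq.2⟩
  have s₀ : shift '' pairsWith (a + 1) (b + 1) Q ⊆ pairs (a + 1) (b + 1) := by
    rintro _ ⟨q, hq, rfl⟩; exact shift_mem.2 hq.1
  have s₁ : shiftLeft '' pairsWith a (b + 1) Q₁ ⊆ pairs (a + 1) (b + 1) := by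
    rintro _ ⟨q, hq, rfl⟩; exact shiftLeft_mem.2 hq.1
  have s₂ : shiftRight '' pairsWith (a + 1) b Q₂ ⊆ pairs (a + 1) (b + 1) := by
    rintro _ ⟨q, hq, rfl⟩; exact shiftRight_mem.2 hq.1
  have s₃ : shiftBoth '' pairsWith a b Q₃ ⊆ pairs (a + 1) (b + 1) := by
    rintro _ ⟨q, hq, rfl⟩; exact shiftBoth_mem.2 hq.1
  have key : genFun (pairsWith (a + 1) (b + 1) Q) =
      X ^ (a + 1 + (b + 1)) * genFun (pairsWith (a + 1) (b + 1) Q) +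
      (X ^ (a + (b + 1)) * genFun (pairsWith a (b + 1) Q₁) +
      (X ^ (a + 1 + b) * genFun (pairsWith (a + 1) b Q₂) +
      X ^ (a + b) * genFun (pairsWith a b Q₃))) := by
    -- The set also occurs on the right of `hS`, so only the left side is unfolded.
    conv_lhs => rw [hS]
    rw [genFun_union s₀ (Set.union_subset s₁ (Set.union_subset s₂ s₃)),
      genFun_union s₁ (Set.union_subset s₂ s₃), genFun_union s₂ s₃,
      genFun_image shift_injective fun p hp => shift_sum hp.1,
      genFun_image shiftLeft_injective fun p hp => shiftLeft_sum hp.1,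
      genFun_image shiftRight_injective fun p hp => shiftRight_sum hp.1,
      genFun_image shiftBoth_injective fun p hp => shiftBoth_sum hp.1]
    · exact disjoint_image shiftRight_ne_shiftBoth
    · exact Set.disjoint_union_right.2 ⟨disjoint_image shiftLeft_ne_shiftRight,
        disjoint_image shiftLeft_ne_shiftBoth⟩
    · exact Set.disjoint_union_right.2 ⟨disjoint_image shift_ne_shiftLeft,
        Set.disjoint_union_right.2 ⟨disjoint_image shift_ne_shiftRight,
          disjoint_image shift_ne_shiftBoth⟩⟩
  linear_combination key

/-- With an empty second row, only `shift` and `shiftLeft` can occur. -/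
theorem genFun_pairsWith_zero_right (a : ℕ) (Q Q₁ : List Bool → Prop)
    (h₁ : ∀ p ∈ pairs a 0, Q (signs (shiftLeft p).1 (shiftLeft p).2) ↔ Q₁ (signs p.1 p.2)) :
    (1 - X ^ (a + 1)) * genFun (pairsWith (a + 1) 0 Q) = X ^ a * genFun (pairsWith a 0 Q₁) := by
  have hS : pairsWith (a + 1) 0 Q =
      shift '' pairsWith (a + 1) 0 Q ∪ shiftLeft '' pairsWith a 0 Q₁ := by
    ext p
    constructor
    · intro hp
      obtain ⟨q, rfl | rfl | rfl | rfl⟩ := exists_shift hp.1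
      · refine .inl ⟨q, ⟨shift_mem.1 hp.1, ?_⟩, rfl⟩
        simpa only [shift, signs_map_succ] using hp.2
      · have hq := shiftLeft_mem.1 hp.1
        exact .inr ⟨q, ⟨hq, (h₁ q hq).1 hp.2⟩, rfl⟩
      · exact absurd hp.1.2.2.2 (by simp [shiftRight])
      · exact absurd hp.1.2.2.2 (by simp [shiftBoth])
    · rintro (⟨q, hq, rfl⟩ | ⟨q, hq, rfl⟩)
      · refine ⟨shift_mem.2 hq.1, ?_⟩
        simpa only [shift, signs_map_succ] using hq.2
      · exact ⟨shiftLeft_mem.2 hq.1, (h₁ q hq.1).2 hq.2⟩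
  have key : genFun (pairsWith (a + 1) 0 Q) =
      X ^ (a + 1 + 0) * genFun (pairsWith (a + 1) 0 Q) +
      X ^ (a + 0) * genFun (pairsWith a 0 Q₁) := by
    conv_lhs => rw [hS]
    rw [genFun_union (a := a + 1) (b := 0),
      genFun_image shift_injective fun p hp => shift_sum hp.1,
      genFun_image shiftLeft_injective fun p hp => shiftLeft_sum hp.1]
    · rintro _ ⟨q, hq, rfl⟩; exact shift_mem.2 hq.1
    · rintro _ ⟨q, hq, rfl⟩; exact shiftLeft_mem.2 hq.1
    · exact disjoint_image shift_ne_shiftLeft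
  linear_combination key

theorem genFun_pairsWith_zero_left (b : ℕ) (Q Q₂ : List Bool → Prop)
    (h₂ : ∀ p ∈ pairs 0 b, Q (signs (shiftRight p).1 (shiftRight p).2) ↔ Q₂ (signs p.1 p.2)) :
    (1 - X ^ (b + 1)) * genFun (pairsWith 0 (b + 1) Q) = X ^ b * genFun (pairsWith 0 b Q₂) := by
  have hS : pairsWith 0 (b + 1) Q =
      shift '' pairsWith 0 (b + 1) Q ∪ shiftRight '' pairsWith 0 b Q₂ := by
    ext p
    constructor
    · intro hp
      obtain ⟨q, rfl | rfl | rfl | rfl⟩ := exists_shift hp.1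
      · refine .inl ⟨q, ⟨shift_mem.1 hp.1, ?_⟩, rfl⟩
        simpa only [shift, signs_map_succ] using hp.2
      · exact absurd hp.1.2.2.1 (by simp [shiftLeft])
      · have hq := shiftRight_mem.1 hp.1
        exact .inr ⟨q, ⟨hq, (h₂ q hq).1 hp.2⟩, rfl⟩
      · exact absurd hp.1.2.2.1 (by simp [shiftBoth])
    · rintro (⟨q, hq, rfl⟩ | ⟨q, hq, rfl⟩)
      · refine ⟨shift_mem.2 hq.1, ?_⟩
        simpa only [shift, signs_map_succ] using hq.2
      · exact ⟨shiftRight_mem.2 hq.1, (h₂ q hq.1).2 hq.2⟩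
  have key : genFun (pairsWith 0 (b + 1) Q) =
      X ^ (0 + (b + 1)) * genFun (pairsWith 0 (b + 1) Q) +
      X ^ (0 + b) * genFun (pairsWith 0 b Q₂) := by
    conv_lhs => rw [hS]
    rw [genFun_union (a := 0) (b := b + 1),
      genFun_image shift_injective fun p hp => shift_sum hp.1,
      genFun_image shiftRight_injective fun p hp => shiftRight_sum hp.1]
    · rintro _ ⟨q, hq, rfl⟩; exact shift_mem.2 hq.1
    · rintro _ ⟨q, hq, rfl⟩; exact shiftRight_mem.2 hq.1
    · exact disjoint_image shift_ne_shiftRight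
  rw [zero_add, zero_add] at key
  linear_combination key

theorem genFun_pairsWith_zero_zero (Q : List Bool → Prop) [Decidable (Q [])] :
    genFun (pairsWith 0 0 Q) = if Q [] then 1 else 0 := by
  have h : ∀ p : List ℕ × List ℕ, p ∈ pairsWith 0 0 Q ↔ p = ([], []) ∧ Q [] := by
    rintro ⟨xs, ys⟩
    constructor
    · rintro ⟨⟨-, -, h1, h2⟩, h3⟩
      rw [List.length_eq_zero_iff] at h1 h2
      simp only at h1 h2
      subst h1 h2
      exact ⟨rfl, by simpa only [signs] using h3⟩
    · rintro ⟨h1, h2⟩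
      rw [Prod.mk.injEq] at h1
      obtain ⟨rfl, rfl⟩ := h1
      exact ⟨by simp [pairs], by simpa only [signs] using h2⟩
  ext n
  simp only [genFun, coeff_mk, h]
  split_ifs with hQ
  · rw [coeff_one]
    split_ifs with hn
    · have : {p : List ℕ × List ℕ | (p = ([], []) ∧ Q []) ∧ p.1.sum + p.2.sum = n} =
          {([], [])} := by
        ext p
        simp only [Set.mem_ofPred_eq, Set.mem_singleton_iff]
        constructor
        · exact fun h => h.1.1
        · rintro rfl
          exact ⟨⟨rfl, hQ⟩, by simp [hn]⟩
      rw [this]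
      simp
    · have : {p : List ℕ × List ℕ | (p = ([], []) ∧ Q []) ∧ p.1.sum + p.2.sum = n} = ∅ := by
        rw [Set.eq_empty_iff_forall_notMem]
        rintro p ⟨⟨rfl, -⟩, h⟩
        exact hn (by simpa using h.symm)
      rw [this]
      simp
  · simp [hQ]

/-! ### The closed forms and their recursions -/

/-- `1 / (q; q)_n`. -/
noncomputable def invPoch (n : ℕ) : ℚ⟦X⟧ := (qPochhammer X X n)⁻¹

theorem constantCoeff_qPochhammer (n : ℕ) : constantCoeff (qPochhammer (X : ℚ⟦X⟧) X n) = 1 := by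
  simp [qPochhammer, map_prod]

theorem qPochhammer_succ (n : ℕ) :
    qPochhammer (X : ℚ⟦X⟧) X (n + 1) = qPochhammer X X n * (1 - X ^ (n + 1)) := by
  rw [qPochhammer, Finset.prod_range_succ, ← qPochhammer, pow_succ' X n]

theorem invPoch_mul (n : ℕ) : invPoch n * qPochhammer X X n = 1 :=
  PowerSeries.inv_mul_cancel _ (by rw [constantCoeff_qPochhammer]; exact one_ne_zero)

theorem invPoch_zero : invPoch 0 = 1 := by
  simpa [qPochhammer] using invPoch_mul 0

theorem invPoch_eq {n m : ℕ} (h : m = n + 1) : invPoch n = (1 - X ^ m) * invPoch m := by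
  subst h
  have h1 := invPoch_mul n
  have h2 := invPoch_mul (n + 1)
  rw [qPochhammer_succ] at h2
  linear_combination (-invPoch n) * h2 + (1 - X ^ (n + 1)) * invPoch (n + 1) * h1

theorem one_sub_X_pow_ne_zero (n : ℕ) : (1 - X ^ (n + 1) : ℚ⟦X⟧) ≠ 0 := by
  intro h
  have := congrArg constantCoeff h
  simp at this

theorem choose_two_succ (n : ℕ) : (n + 1).choose 2 = n.choose 2 + n := by
  rw [Nat.choose_succ_succ' n 1, Nat.choose_one_right, add_comm]

/-- The closed form of `upGen`. -/
noncomputable def upForm (k a b : ℕ) : ℚ⟦X⟧ :=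
  if k ≤ b then
    X ^ (a.choose 2 + b.choose 2 + (a - b) * k + k.choose 2) * invPoch (a + k) * invPoch (b - k)
  else 0

/-- The closed form of `downGen`. -/
noncomputable def downForm (k a b : ℕ) : ℚ⟦X⟧ :=
  if k ≤ a then
    X ^ (a.choose 2 + b.choose 2 + (b - a) * k + (k + 1).choose 2) * invPoch (a - k) *
      invPoch (b + k)
  else 0

/-- The truncated differences become variables `t` and `v`, so that after substitution the
recursions are polynomial identities for `ring`. -/
theorem upForm_eq (k a b t v : ℕ) (ha : a = b + t) (hb : b = k + v) :
    upForm k a b =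
      X ^ (a.choose 2 + b.choose 2 + t * k + k.choose 2) * invPoch (a + k) * invPoch v := by
  rw [upForm, if_pos (by omega), show a - b = t by omega, show b - k = v by omega]

theorem upForm_eq_zero {k a b : ℕ} (h : b < k) : upForm k a b = 0 :=
  if_neg (by omega)

theorem downForm_eq (k a b t v : ℕ) (hb : b = a + t) (ha : a = k + v) :
    downForm k a b =
      X ^ (a.choose 2 + b.choose 2 + t * k + k.choose 2 + k) * invPoch v * invPoch (b + k) := by
  rw [downForm, if_pos (by omega), show b - a = t by omega, show a - k = v by omega,
    choose_two_succ, ← add_assoc]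

theorem downForm_eq_zero {k a b : ℕ} (h : a < k) : downForm k a b = 0 :=
  if_neg (by omega)

/-- Each `invPoch` is expressed through the one of largest index, which leaves a polynomial
identity. The cases `k = b + 1`, where the terms of second length `b` vanish, and `k > b + 1`, where
all vanish, are separate. -/
theorem upForm_succ_succ (k a b : ℕ) (h : b < a) :
    (1 - X ^ (a + b + 2)) * upForm k (a + 1) (b + 1) =
      X ^ (a + b + 1) * (upForm k a (b + 1) + upForm k (a + 1) b) + X ^ (a + b) * upForm k a b := by
  obtain ⟨t, ht⟩ := Nat.exists_eq_add_of_le (Nat.succ_le_of_lt h)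
  rcases le_or_gt k b with hk | hk
  · obtain ⟨v, hv⟩ := Nat.exists_eq_add_of_le hk
    rw [upForm_eq k (a + 1) (b + 1) (t + 1) (v + 1) (by omega) (by omega),
      upForm_eq k a (b + 1) t (v + 1) (by omega) (by omega),
      upForm_eq k (a + 1) b (t + 2) v (by omega) (by omega),
      upForm_eq k a b (t + 1) v (by omega) (by omega),
      invPoch_eq (show a + 1 + k = a + k + 1 by omega), invPoch_eq (show v + 1 = v + 1 by rfl),
      choose_two_succ a, choose_two_succ b]
    generalize a.choose 2 = α, b.choose 2 = β, invPoch (a + 1 + k) = I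
    subst ht hv
    ring
  · rcases Nat.eq_or_lt_of_le hk with hk | hk
    · rw [upForm_eq k (a + 1) (b + 1) (t + 1) 0 (by omega) (by omega),
        upForm_eq k a (b + 1) t 0 (by omega) (by omega),
        upForm_eq_zero (b := b) (by omega), upForm_eq_zero (b := b) (by omega),
        invPoch_eq (show a + 1 + k = a + k + 1 by omega),
        choose_two_succ a, choose_two_succ b]
      generalize a.choose 2 = α, b.choose 2 = β, invPoch (a + 1 + k) = I
      obtain rfl : b + 1 = k := hk
      subst ht
      ring
    · rw [upForm_eq_zero (by omega), upForm_eq_zero (by omega), upForm_eq_zero (by omega),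
        upForm_eq_zero (by omega)]
      ring

theorem downForm_succ_succ (k a b : ℕ) (h : a < b) :
    (1 - X ^ (a + b + 2)) * downForm k (a + 1) (b + 1) =
      X ^ (a + b + 1) * (downForm k a (b + 1) + downForm k (a + 1) b) +
        X ^ (a + b) * downForm k a b := by
  obtain ⟨t, ht⟩ := Nat.exists_eq_add_of_le (Nat.succ_le_of_lt h)
  rcases le_or_gt k a with hk | hk
  · obtain ⟨v, hv⟩ := Nat.exists_eq_add_of_le hk
    rw [downForm_eq k (a + 1) (b + 1) (t + 1) (v + 1) (by omega) (by omega),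
      downForm_eq k (a + 1) b t (v + 1) (by omega) (by omega),
      downForm_eq k a (b + 1) (t + 2) v (by omega) (by omega),
      downForm_eq k a b (t + 1) v (by omega) (by omega),
      invPoch_eq (show b + 1 + k = b + k + 1 by omega), invPoch_eq (show v + 1 = v + 1 by rfl),
      choose_two_succ a, choose_two_succ b]
    generalize a.choose 2 = α, b.choose 2 = β, invPoch (b + 1 + k) = I
    subst ht hv
    ring
  · rcases Nat.eq_or_lt_of_le hk with hk | hk
    · rw [downForm_eq k (a + 1) (b + 1) (t + 1) 0 (by omega) (by omega),
        downForm_eq k (a + 1) b t 0 (by omega) (by omega),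
        downForm_eq_zero (a := a) (by omega), downForm_eq_zero (a := a) (by omega),
        invPoch_eq (show b + 1 + k = b + k + 1 by omega),
        choose_two_succ a, choose_two_succ b]
      generalize a.choose 2 = α, b.choose 2 = β, invPoch (b + 1 + k) = I
      obtain rfl : a + 1 = k := hk
      subst ht
      ring
    · rw [downForm_eq_zero (by omega), downForm_eq_zero (by omega), downForm_eq_zero (by omega),
        downForm_eq_zero (by omega)]
      ring

/-- For `k = 0` the truncated `k - 1` is again `0`, which requires its own identity. -/
theorem upForm_diag_succ (k a : ℕ) :
    (1 - X ^ (a + a + 2)) * upForm k (a + 1) (a + 1) =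
      X ^ (a + a + 1) * (downForm (k - 1) a (a + 1) + upForm k (a + 1) a) +
        X ^ (a + a) * downForm (k - 1) a a := by
  cases k with
  | zero =>
    rw [upForm_eq 0 (a + 1) (a + 1) 0 (a + 1) (by omega) (by omega),
      upForm_eq 0 (a + 1) a 1 a (by omega) (by omega),
      downForm_eq (0 - 1) a (a + 1) 1 a (by omega) (by omega),
      downForm_eq (0 - 1) a a 0 a (by omega) (by omega), choose_two_succ a]
    simp only [Nat.add_zero, Nat.zero_sub, invPoch_eq (show a + 1 = a + 1 by rfl)]
    generalize a.choose 2 = α, invPoch (a + 1) = I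
    ring
  | succ k =>
    rw [Nat.add_sub_cancel]
    rcases le_or_gt (k + 1) a with hk | hk
    · obtain ⟨v, hv⟩ := Nat.exists_eq_add_of_le hk
      rw [upForm_eq (k + 1) (a + 1) (a + 1) 0 (v + 1) (by omega) (by omega),
        upForm_eq (k + 1) (a + 1) a 1 v (by omega) (by omega),
        downForm_eq k a (a + 1) 1 (v + 1) (by omega) (by omega),
        downForm_eq k a a 0 (v + 1) (by omega) (by omega),
        invPoch_eq (show a + 1 + k = a + k + 1 by omega),
        invPoch_eq (show a + 1 + (k + 1) = a + 1 + k + 1 by omega),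
        invPoch_eq (show v + 1 = v + 1 by rfl),
        choose_two_succ a, choose_two_succ k]
      generalize a.choose 2 = α, k.choose 2 = β, invPoch (a + 1 + (k + 1)) = I
      subst hv
      ring
    · rcases Nat.eq_or_lt_of_le hk with hk | hk
      · have hk : a = k := by omega
        rw [upForm_eq (k + 1) (a + 1) (a + 1) 0 0 (by omega) (by omega),
          upForm_eq_zero (b := a) (by omega),
          downForm_eq k a (a + 1) 1 0 (by omega) (by omega),
          downForm_eq k a a 0 0 (by omega) (by omega),
          invPoch_eq (show a + 1 + k = a + k + 1 by omega),
          invPoch_eq (show a + 1 + (k + 1) = a + 1 + k + 1 by omega),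
          choose_two_succ a, choose_two_succ k]
        generalize invPoch (a + 1 + (k + 1)) = I
        subst hk
        generalize a.choose 2 = α
        ring
      · rw [upForm_eq_zero (by omega), upForm_eq_zero (by omega), downForm_eq_zero (by omega),
          downForm_eq_zero (by omega)]
        ring

theorem downForm_diag_succ (k a : ℕ) :
    (1 - X ^ (a + a + 2)) * downForm k (a + 1) (a + 1) =
      X ^ (a + a + 1) * (downForm k a (a + 1) + upForm (k - 1) (a + 1) a) +
        X ^ (a + a) * downForm k a a := by
  cases k with
  | zero =>
    rw [downForm_eq 0 (a + 1) (a + 1) 0 (a + 1) (by omega) (by omega),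
      upForm_eq (0 - 1) (a + 1) a 1 a (by omega) (by omega),
      downForm_eq 0 a (a + 1) 1 a (by omega) (by omega),
      downForm_eq 0 a a 0 a (by omega) (by omega), choose_two_succ a]
    simp only [Nat.add_zero, Nat.zero_sub, invPoch_eq (show a + 1 = a + 1 by rfl)]
    generalize a.choose 2 = α, invPoch (a + 1) = I
    ring
  | succ k =>
    rw [Nat.add_sub_cancel]
    rcases le_or_gt (k + 1) a with hk | hk
    · obtain ⟨v, hv⟩ := Nat.exists_eq_add_of_le hk
      rw [downForm_eq (k + 1) (a + 1) (a + 1) 0 (v + 1) (by omega) (by omega),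
        upForm_eq k (a + 1) a 1 (v + 1) (by omega) (by omega),
        downForm_eq (k + 1) a (a + 1) 1 v (by omega) (by omega),
        downForm_eq (k + 1) a a 0 v (by omega) (by omega),
        show a + (k + 1) = a + 1 + k by omega,
        invPoch_eq (show a + 1 + (k + 1) = a + 1 + k + 1 by omega),
        invPoch_eq (show v + 1 = v + 1 by rfl),
        choose_two_succ a, choose_two_succ k]
      generalize a.choose 2 = α, k.choose 2 = β, invPoch (a + 1 + (k + 1)) = I
      subst hv
      ring
    · rcases Nat.eq_or_lt_of_le hk with hk | hk
      · have hk : a = k := by omega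
        rw [downForm_eq (k + 1) (a + 1) (a + 1) 0 0 (by omega) (by omega),
          upForm_eq k (a + 1) a 1 0 (by omega) (by omega),
          downForm_eq_zero (a := a) (by omega), downForm_eq_zero (a := a) (by omega),
          invPoch_eq (show a + 1 + (k + 1) = a + 1 + k + 1 by omega),
          choose_two_succ a, choose_two_succ k]
        generalize invPoch (a + 1 + (k + 1)) = I
        subst hk
        generalize a.choose 2 = α
        ring
      · rw [upForm_eq_zero (by omega), downForm_eq_zero (by omega), downForm_eq_zero (by omega),
          downForm_eq_zero (by omega)]
        ring

theorem upForm_zero_right (k a : ℕ) :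
    (1 - X ^ (a + 1)) * upForm k (a + 1) 0 = X ^ a * upForm k a 0 := by
  rcases Nat.eq_zero_or_pos k with rfl | hk
  · rw [upForm_eq 0 (a + 1) 0 (a + 1) 0 (by omega) (by omega),
      upForm_eq 0 a 0 a 0 (by omega) (by omega), choose_two_succ a]
    simp only [Nat.add_zero, invPoch_eq (show a + 1 = a + 1 by rfl)]
    ring
  · rw [upForm_eq_zero hk, upForm_eq_zero hk, mul_zero, mul_zero]

theorem downForm_zero_left (k b : ℕ) :
    (1 - X ^ (b + 1)) * downForm k 0 (b + 1) = X ^ b * downForm k 0 b := by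
  rcases Nat.eq_zero_or_pos k with rfl | hk
  · rw [downForm_eq 0 0 (b + 1) (b + 1) 0 (by omega) (by omega),
      downForm_eq 0 0 b b 0 (by omega) (by omega), choose_two_succ b]
    simp only [Nat.add_zero, invPoch_eq (show b + 1 = b + 1 by rfl)]
    ring
  · rw [downForm_eq_zero hk, downForm_eq_zero hk, mul_zero, mul_zero]

/-! ### Counting by runs: the recursions and the closed form -/

/-- The generating function of the pairs with more than `k` runs of signs after a further positive
column. -/
noncomputable def upGen (k a b : ℕ) : ℚ⟦X⟧ :=
  genFun (pairsWith a b fun s => k < runs (s ++ [true]))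

/-- The generating function of the pairs with more than `k` runs of signs after a further negative
column. -/
noncomputable def downGen (k a b : ℕ) : ℚ⟦X⟧ :=
  genFun (pairsWith a b fun s => k < runs (s ++ [false]))

variable {p : List ℕ × List ℕ}

theorem signs_shiftLeft_of_le (h : p.2.length ≤ p.1.length) :
    signs (shiftLeft p).1 (shiftLeft p).2 = signs p.1 p.2 ++ [true] := by
  rw [shiftLeft, signs_concat_left (by simpa using h), signs_map_succ]

theorem signs_shiftLeft_of_lt (h : p.1.length < p.2.length) :
    signs (shiftLeft p).1 (shiftLeft p).2 = signs p.1 p.2 := by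
  rw [shiftLeft, signs_concat_zero_left (by simpa using h), signs_map_succ]

theorem signs_shiftRight_of_le (h : p.1.length ≤ p.2.length) :
    signs (shiftRight p).1 (shiftRight p).2 = signs p.1 p.2 ++ [false] := by
  rw [shiftRight, signs_concat_right (by simpa using h), signs_map_succ]

theorem signs_shiftRight_of_lt (h : p.2.length < p.1.length) :
    signs (shiftRight p).1 (shiftRight p).2 = signs p.1 p.2 := by
  rw [shiftRight, signs_concat_zero_right (by simpa using h), signs_map_succ]

theorem signs_shiftBoth_of_lt (h : p.2.length < p.1.length) :
    signs (shiftBoth p).1 (shiftBoth p).2 = signs p.1 p.2 ++ [true] := by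
  rw [shiftBoth, signs_concat_left (by simpa using h), signs_concat_zero_right (by simpa using h),
    signs_map_succ]

theorem signs_shiftBoth_of_le (h : p.1.length ≤ p.2.length) :
    signs (shiftBoth p).1 (shiftBoth p).2 = signs p.1 p.2 ++ [false] := by
  rw [shiftBoth, signs_concat_zero_left (by simpa [Nat.lt_succ_iff] using h),
    signs_concat_right (by simpa using h), signs_map_succ]

/-- While the first row is strictly longer, a zero either changes no sign or adds a positive column,
which merges with the further positive column. -/
theorem upGen_succ_succ (k a b : ℕ) (h : b < a) :
    (1 - X ^ (a + b + 2)) * upGen k (a + 1) (b + 1) =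
      X ^ (a + b + 1) * (upGen k a (b + 1) + upGen k (a + 1) b) + X ^ (a + b) * upGen k a b := by
  refine genFun_pairsWith_eq a b _ _ _ _ ?_ ?_ ?_
  · rintro p ⟨-, -, h1, h2⟩
    rw [signs_shiftLeft_of_le (by omega), runs_append_same]
  · rintro p ⟨-, -, h1, h2⟩
    rw [signs_shiftRight_of_lt (by omega)]
  · rintro p ⟨-, -, h1, h2⟩
    rw [signs_shiftBoth_of_lt (by omega), runs_append_same]

theorem downGen_succ_succ (k a b : ℕ) (h : a < b) :
    (1 - X ^ (a + b + 2)) * downGen k (a + 1) (b + 1) =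
      X ^ (a + b + 1) * (downGen k a (b + 1) + downGen k (a + 1) b) +
        X ^ (a + b) * downGen k a b := by
  refine genFun_pairsWith_eq a b _ _ _ _ ?_ ?_ ?_
  · rintro p ⟨-, -, h1, h2⟩
    rw [signs_shiftLeft_of_lt (by omega)]
  · rintro p ⟨-, -, h1, h2⟩
    rw [signs_shiftRight_of_le (by omega), runs_append_same]
  · rintro p ⟨-, -, h1, h2⟩
    rw [signs_shiftBoth_of_le (by omega), runs_append_same]

/-- A source with the second row longer, or a final column `(0, 0)`, makes the last sign negative;
the further positive column then starts a new run, so the threshold drops to `k - 1`. Truncation at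
`k = 0` is harmless since the remaining run count is positive. -/
theorem upGen_diag_succ (k a : ℕ) :
    (1 - X ^ (a + a + 2)) * upGen k (a + 1) (a + 1) =
      X ^ (a + a + 1) * (downGen (k - 1) a (a + 1) + upGen k (a + 1) a) +
        X ^ (a + a) * downGen (k - 1) a a := by
  refine genFun_pairsWith_eq a a _ _ _ _ ?_ ?_ ?_
  · rintro p ⟨-, -, h1, h2⟩
    obtain ⟨s, hs⟩ := exists_signs_eq_concat_false (xs := p.1) (ys := p.2) (by omega)
    have := runs_pos s false
    rw [signs_shiftLeft_of_lt (by omega), hs, runs_append_same, runs_append_ne _ (by simp)]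
    omega
  · rintro p ⟨-, -, h1, h2⟩
    rw [signs_shiftRight_of_lt (by omega)]
  · rintro p ⟨-, -, h1, h2⟩
    have := runs_pos (signs p.1 p.2) false
    rw [signs_shiftBoth_of_le (by omega), runs_append_ne _ (by simp)]
    omega

theorem downGen_diag_succ (k a : ℕ) :
    (1 - X ^ (a + a + 2)) * downGen k (a + 1) (a + 1) =
      X ^ (a + a + 1) * (downGen k a (a + 1) + upGen (k - 1) (a + 1) a) +
        X ^ (a + a) * downGen k a a := by
  refine genFun_pairsWith_eq a a _ _ _ _ ?_ ?_ ?_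
  · rintro p ⟨-, -, h1, h2⟩
    rw [signs_shiftLeft_of_lt (by omega)]
  · rintro p ⟨-, -, h1, h2⟩
    obtain ⟨s, hs⟩ := exists_signs_eq_concat_true (xs := p.1) (ys := p.2) (by omega)
    have := runs_pos s true
    rw [signs_shiftRight_of_lt (by omega), hs, runs_append_same, runs_append_ne _ (by simp)]
    omega
  · rintro p ⟨-, -, h1, h2⟩
    rw [signs_shiftBoth_of_le (by omega), runs_append_same]

theorem upGen_zero_right (k a : ℕ) :
    (1 - X ^ (a + 1)) * upGen k (a + 1) 0 = X ^ a * upGen k a 0 := by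
  refine genFun_pairsWith_zero_right a _ _ ?_
  rintro p ⟨-, -, h1, h2⟩
  rw [signs_shiftLeft_of_le (by omega), runs_append_same]

theorem downGen_zero_left (k b : ℕ) :
    (1 - X ^ (b + 1)) * downGen k 0 (b + 1) = X ^ b * downGen k 0 b := by
  refine genFun_pairsWith_zero_left b _ _ ?_
  rintro p ⟨-, -, h1, h2⟩
  rw [signs_shiftRight_of_le (by omega), runs_append_same]

theorem upGen_zero_zero (k : ℕ) : upGen k 0 0 = upForm k 0 0 := by
  rw [upGen, genFun_pairsWith_zero_zero]
  rcases Nat.eq_zero_or_pos k with rfl | hk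
  · simp [upForm, runs, invPoch_zero]
  · rw [upForm_eq_zero hk, if_neg (by simp [runs]; omega)]

theorem downGen_zero_zero (k : ℕ) : downGen k 0 0 = downForm k 0 0 := by
  rw [downGen, genFun_pairsWith_zero_zero]
  rcases Nat.eq_zero_or_pos k with rfl | hk
  · simp [downForm, runs, invPoch_zero]
  · rw [downForm_eq_zero hk, if_neg (by simp [runs]; omega)]

/-- Both claims are proved together because the diagonal recursions mix them. Each is needed only on
its own side of the diagonal, and the recursions never leave that region. -/
theorem upGen_and_downGen_eq (N : ℕ) : ∀ a b k : ℕ, a + b = N →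
    (b ≤ a → upGen k a b = upForm k a b) ∧ (a ≤ b → downGen k a b = downForm k a b) := by
  induction N using Nat.strong_induction_on with
  | _ N ih =>
  intro a b k hN
  have hu : ∀ a' b' k', a' + b' < N → b' ≤ a' → upGen k' a' b' = upForm k' a' b' :=
    fun a' b' k' h h' => (ih _ h a' b' k' rfl).1 h'
  have hd : ∀ a' b' k', a' + b' < N → a' ≤ b' → downGen k' a' b' = downForm k' a' b' :=
    fun a' b' k' h h' => (ih _ h a' b' k' rfl).2 h'
  rcases a with _ | a <;> rcases b with _ | b
  · exact ⟨fun _ => upGen_zero_zero k, fun _ => downGen_zero_zero k⟩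
  · refine ⟨fun h => by omega, fun _ => mul_left_cancel₀ (one_sub_X_pow_ne_zero b) ?_⟩
    rw [downGen_zero_left, downForm_zero_left, hd _ _ _ (by omega) (by omega)]
  · refine ⟨fun _ => mul_left_cancel₀ (one_sub_X_pow_ne_zero a) ?_, fun h => by omega⟩
    rw [upGen_zero_right, upForm_zero_right, hu _ _ _ (by omega) (by omega)]
  · rcases lt_trichotomy a b with h | rfl | h
    · refine ⟨fun h => by omega, fun _ => mul_left_cancel₀ (one_sub_X_pow_ne_zero (a + b + 1)) ?_⟩
      rw [downGen_succ_succ _ _ _ h, downForm_succ_succ _ _ _ h, hd _ _ _ (by omega) (by omega),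
        hd _ _ _ (by omega) (by omega), hd _ _ _ (by omega) (by omega)]
    · constructor <;> refine fun _ => mul_left_cancel₀ (one_sub_X_pow_ne_zero (a + a + 1)) ?_
      · rw [upGen_diag_succ, upForm_diag_succ, hd _ _ _ (by omega) (by omega),
          hd _ _ _ (by omega) (by omega), hu _ _ _ (by omega) (by omega)]
      · rw [downGen_diag_succ, downForm_diag_succ, hd _ _ _ (by omega) (by omega),
          hd _ _ _ (by omega) (by omega), hu _ _ _ (by omega) (by omega)]
    · refine ⟨fun _ => mul_left_cancel₀ (one_sub_X_pow_ne_zero (a + b + 1)) ?_, fun h => by omega⟩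
      rw [upGen_succ_succ _ _ _ h, upForm_succ_succ _ _ _ h, hu _ _ _ (by omega) (by omega),
        hu _ _ _ (by omega) (by omega), hu _ _ _ (by omega) (by omega)]

/-! ### Prescribed last sign and exact number of runs -/

theorem genFun_pairsWith_false (a b : ℕ) : genFun (pairsWith a b fun _ => False) = 0 := by
  rw [show pairsWith a b (fun _ => False) = ∅ from
    Set.eq_empty_iff_forall_notMem.2 fun _ hp => hp.2, genFun_empty]

/-- The generating function of the pairs of lists of length `a` with more than `k` runs of signs,
the last sign being `t`. -/
noncomputable def lastGen (t : Bool) (k a : ℕ) : ℚ⟦X⟧ :=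
  genFun (pairsWith a a fun s => k < runs s ∧ s.getLast? = some t)

/-- A positive last column arises, apart from `shift`, only from a longer first row; its last sign
is already positive, so the further positive column in `upGen` costs nothing. -/
theorem lastGen_true_succ (k a : ℕ) :
    (1 - X ^ (a + a + 2)) * lastGen true k (a + 1) = X ^ (a + a + 1) * upForm k (a + 1) a := by
  rw [← (upGen_and_downGen_eq _ (a + 1) a k rfl).1 (by omega)]
  refine (genFun_pairsWith_eq a a _ (fun _ => False) (fun s => k < runs (s ++ [true]))
    (fun _ => False) ?_ ?_ ?_).trans ?_
  · rintro p ⟨-, -, h1, h2⟩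
    obtain ⟨s, hs⟩ := exists_signs_eq_concat_false (xs := p.1) (ys := p.2) (by omega)
    rw [signs_shiftLeft_of_lt (by omega), hs]
    simp
  · rintro p ⟨-, -, h1, h2⟩
    obtain ⟨s, hs⟩ := exists_signs_eq_concat_true (xs := p.1) (ys := p.2) (by omega)
    rw [signs_shiftRight_of_lt (by omega), hs, runs_append_same]
    simp
  · rintro p ⟨-, -, h1, h2⟩
    rw [signs_shiftBoth_of_le (by omega)]
    simp
  · rw [genFun_pairsWith_false, genFun_pairsWith_false, upGen]
    ring

theorem lastGen_false_succ (k a : ℕ) :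
    (1 - X ^ (a + a + 2)) * lastGen false k (a + 1) =
      X ^ (a + a + 1) * downForm k a (a + 1) + X ^ (a + a) * downForm k a a := by
  rw [← (upGen_and_downGen_eq _ a (a + 1) k rfl).2 (by omega),
    ← (upGen_and_downGen_eq _ a a k rfl).2 le_rfl]
  refine (genFun_pairsWith_eq a a _ (fun s => k < runs (s ++ [false])) (fun _ => False)
    (fun s => k < runs (s ++ [false])) ?_ ?_ ?_).trans ?_
  · rintro p ⟨-, -, h1, h2⟩
    obtain ⟨s, hs⟩ := exists_signs_eq_concat_false (xs := p.1) (ys := p.2) (by omega)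
    rw [signs_shiftLeft_of_lt (by omega), hs, runs_append_same]
    simp
  · rintro p ⟨-, -, h1, h2⟩
    obtain ⟨s, hs⟩ := exists_signs_eq_concat_true (xs := p.1) (ys := p.2) (by omega)
    rw [signs_shiftRight_of_lt (by omega), hs]
    simp
  · rintro p ⟨-, -, h1, h2⟩
    rw [signs_shiftBoth_of_le (by omega)]
    simp
  · rw [genFun_pairsWith_false, downGen, downGen]
    ring

theorem genFun_runs_eq (t : Bool) (k a : ℕ) :
    genFun (pairsWith a a fun s => runs s = k + 1 ∧ s.getLast? = some t) =
      lastGen t k a - lastGen t (k + 1) a := by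
  rw [eq_sub_iff_add_eq, lastGen, lastGen,
    ← genFun_union (pairsWith_subset _ _ _) (pairsWith_subset _ _ _)]
  · congr 1
    ext p
    simp only [pairsWith, Set.mem_union, Set.mem_ofPred_eq]
    rw [← and_or_left, ← or_and_right]
    exact and_congr_right fun _ => and_congr_left fun _ => by omega
  · rw [Set.disjoint_left]
    rintro p ⟨-, h1, -⟩ ⟨-, h2, -⟩
    omega

theorem sq_eq_choose_two (n : ℕ) : n ^ 2 = n.choose 2 + n.choose 2 + n := by
  induction n with
  | zero => rfl
  | succ n ih => rw [choose_two_succ]; linarith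

/-- Over the common factor `invPoch (a + k + 2) * invPoch (a - k)`, the difference has numerator `(1
- X^(a+k+2)) - X^(k+1) (1 - X^(a-k)) = (1 - X^(k+1)) (1 + X^(a+1))`, and `1 + X^(a+1)` cancels
against `1 - X^(2a+2)`. -/
theorem X_pow_mul_lastGen_true {k a : ℕ} (h : k ≤ a) :
    X ^ (a + 1) * (lastGen true k (a + 1) - lastGen true (k + 1) (a + 1)) =
      X ^ ((a + 1) ^ 2 + (a + 1) + (k + 1).choose 2) *
        ((1 - X ^ (k + 1)) * (1 - X ^ (a + 1))⁻¹) *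
        (invPoch (a + 1 + (k + 1)) * invPoch (a - k)) := by
  refine mul_left_cancel₀ (one_sub_X_pow_ne_zero (a + a + 1)) ?_
  have h1 := lastGen_true_succ k a
  have h2 := lastGen_true_succ (k + 1) a
  have hJ : (1 - X ^ (a + 1)) * (1 - X ^ (a + 1) : ℚ⟦X⟧)⁻¹ = 1 :=
    PowerSeries.mul_inv_cancel _ (by simp)
  -- The inverse becomes an atom known only through `hJ`.
  generalize (1 - X ^ (a + 1) : ℚ⟦X⟧)⁻¹ = J at hJ ⊢
  obtain ⟨v, hv⟩ := Nat.exists_eq_add_of_le h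
  rw [upForm_eq k (a + 1) a 1 v (by omega) (by omega), choose_two_succ,
    invPoch_eq (show a + 1 + (k + 1) = a + 1 + k + 1 by omega)] at h1
  rw [show a - k = v by omega, sq_eq_choose_two (a + 1), choose_two_succ a, choose_two_succ k]
  cases v with
  | zero =>
    rw [upForm_eq_zero (by omega)] at h2
    obtain rfl : a = k := hv
    linear_combination X ^ (a + 1) * (h1 - h2) -
      X ^ (a.choose 2 + a.choose 2 + 4 * a + 2 + a.choose 2 + a) *
        ((1 - X ^ (a + 1)) * (1 + X ^ (a + 1))) * invPoch (a + 1 + (a + 1)) * invPoch 0 * hJ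
  | succ v =>
    rw [upForm_eq (k + 1) (a + 1) a 1 v (by omega) (by omega), choose_two_succ,
      choose_two_succ, invPoch_eq (show v + 1 = v + 1 by rfl)] at h2
    subst hv
    linear_combination X ^ (k + (v + 1) + 1) * (h1 - h2) -
      X ^ (2 * (k + (v + 1)).choose 2 + 4 * (k + (v + 1)) + 2 + k.choose 2 + k) *
        ((1 - X ^ (k + 1)) * (1 + X ^ (k + (v + 1) + 1))) *
          invPoch (k + (v + 1) + 1 + (k + 1)) * invPoch (v + 1) * hJ

/-- The two terms of `lastGen_false_succ` combine into one product, since `X^(a+k+1) + (1 -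
X^(a+k+1)) = 1`; the difference then factors as in the positive case. -/
theorem X_pow_mul_lastGen_false {k a : ℕ} (h : k ≤ a) :
    X ^ (a + 1) * (lastGen false k (a + 1) - lastGen false (k + 1) (a + 1)) =
      X ^ ((a + 1) ^ 2 + (k + 1).choose 2) *
        ((1 - X ^ (k + 1)) * (1 - X ^ (a + 1))⁻¹) *
        (invPoch (a + 1 + (k + 1)) * invPoch (a - k)) := by
  refine mul_left_cancel₀ (one_sub_X_pow_ne_zero (a + a + 1)) ?_
  have h1 := lastGen_false_succ k a
  have h2 := lastGen_false_succ (k + 1) a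
  have hJ : (1 - X ^ (a + 1)) * (1 - X ^ (a + 1) : ℚ⟦X⟧)⁻¹ = 1 :=
    PowerSeries.mul_inv_cancel _ (by simp)
  generalize (1 - X ^ (a + 1) : ℚ⟦X⟧)⁻¹ = J at hJ ⊢
  obtain ⟨v, hv⟩ := Nat.exists_eq_add_of_le h
  rw [downForm_eq k a (a + 1) 1 v (by omega) (by omega),
    downForm_eq k a a 0 v (by omega) (by omega), choose_two_succ,
    invPoch_eq (show a + 1 + k = a + k + 1 by omega),
    invPoch_eq (show a + 1 + (k + 1) = a + 1 + k + 1 by omega)] at h1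
  rw [show a - k = v by omega, sq_eq_choose_two (a + 1), choose_two_succ a, choose_two_succ k]
  cases v with
  | zero =>
    rw [downForm_eq_zero (by omega), downForm_eq_zero (by omega)] at h2
    obtain rfl : a = k := hv
    linear_combination X ^ (a + 1) * (h1 - h2) -
      X ^ (a.choose 2 + a.choose 2 + 3 * a + 1 + a.choose 2 + a) *
        ((1 - X ^ (a + 1)) * (1 + X ^ (a + 1))) * invPoch (a + 1 + (a + 1)) * invPoch 0 * hJ
  | succ v =>
    rw [downForm_eq (k + 1) a (a + 1) 1 v (by omega) (by omega),
      downForm_eq (k + 1) a a 0 v (by omega) (by omega),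
      show a + (k + 1) = a + 1 + k by omega,
      invPoch_eq (show a + 1 + (k + 1) = a + 1 + k + 1 by omega), choose_two_succ,
      choose_two_succ, invPoch_eq (show v + 1 = v + 1 by rfl)] at h2
    subst hv
    linear_combination X ^ (k + (v + 1) + 1) * (h1 - h2) -
      X ^ (2 * (k + (v + 1)).choose 2 + 3 * (k + (v + 1)) + 1 + k.choose 2 + k) *
        ((1 - X ^ (k + 1)) * (1 + X ^ (k + (v + 1) + 1))) *
          invPoch (k + (v + 1) + 1 + (k + 1)) * invPoch (v + 1) * hJ

/-! ### Frobenius symbols of Young diagrams -/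

/-- The Frobenius symbol of a Young diagram with `d` diagonal cells, as a pair of rows. -/
def frobeniusRows (μ : YoungDiagram) (d : ℕ) : List ℕ × List ℕ :=
  ((List.range d).map fun i => μ.rowLen i - (i + 1),
    (List.range d).map fun i => μ.colLen i - (i + 1))

/-- The Young diagram `μ` has exactly `d` diagonal cells. -/
def HasDiag (μ : YoungDiagram) (d : ℕ) : Prop := ∀ i, (i, i) ∈ μ ↔ i < d

variable {μ : YoungDiagram} {d : ℕ}

theorem HasDiag.lt_rowLen (h : HasDiag μ d) {i : ℕ} (hi : i < d) : i < μ.rowLen i :=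
  YoungDiagram.mem_iff_lt_rowLen.1 ((h i).2 hi)

theorem HasDiag.lt_colLen (h : HasDiag μ d) {i : ℕ} (hi : i < d) : i < μ.colLen i :=
  YoungDiagram.mem_iff_lt_colLen.1 ((h i).2 hi)

/-- A cell on or right of the diagonal is governed by its row, a cell below by its column, so the
symbol determines the diagram. -/
theorem HasDiag.mem_iff (h : HasDiag μ d) (i j : ℕ) : (i, j) ∈ μ ↔
    (i ≤ j ∧ i < d ∧ j ≤ i + (μ.rowLen i - (i + 1))) ∨
      (j < i ∧ j < d ∧ i ≤ j + (μ.colLen j - (j + 1))) := by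
  rcases le_or_gt i j with hij | hij
  · rw [YoungDiagram.mem_iff_lt_rowLen]
    constructor
    · intro hj
      have hi : (i, i) ∈ μ := μ.up_left_mem le_rfl hij (YoungDiagram.mem_iff_lt_rowLen.2 hj)
      exact .inl ⟨hij, (h i).1 hi, by omega⟩
    · rintro (⟨-, h1, h2⟩ | ⟨h1, -⟩)
      · have := h.lt_rowLen h1
        omega
      · omega
  · rw [YoungDiagram.mem_iff_lt_colLen]
    constructor
    · intro hi
      have hj : (j, j) ∈ μ := μ.up_left_mem hij.le le_rfl (YoungDiagram.mem_iff_lt_colLen.2 hi)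
      exact .inr ⟨hij, (h j).1 hj, by omega⟩
    · rintro (⟨h1, -⟩ | ⟨-, h1, h2⟩)
      · omega
      · have := h.lt_colLen h1
        omega

theorem HasDiag.frobeniusRows_mem (h : HasDiag μ d) : frobeniusRows μ d ∈ pairs d d := by
  refine ⟨?_, ?_, by simp [frobeniusRows], by simp [frobeniusRows]⟩
  · refine List.pairwise_map.2 (List.pairwise_lt_range.imp_of_mem fun {i j} _ hj hij => ?_)
    have h1 := h.lt_rowLen (List.mem_range.1 hj)
    have h2 := μ.rowLen_anti i j hij.le
    omega
  · refine List.pairwise_map.2 (List.pairwise_lt_range.imp_of_mem fun {i j} _ hj hij => ?_)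
    have h1 := h.lt_colLen (List.mem_range.1 hj)
    have h2 := μ.colLen_anti i j hij.le
    omega

theorem eq_of_frobeniusRows_eq {ν : YoungDiagram} (hμ : HasDiag μ d) (hν : HasDiag ν d)
    (h : frobeniusRows μ d = frobeniusRows ν d) : μ = ν := by
  simp only [frobeniusRows, Prod.mk.injEq, List.map_inj_left, List.mem_range] at h
  ext ⟨i, j⟩
  rw [YoungDiagram.mem_cells, YoungDiagram.mem_cells, hμ.mem_iff, hν.mem_iff]
  have h1 := h.1 i
  have h2 := h.2 j
  constructor <;>
  · rintro (⟨h3, h4, h5⟩ | ⟨h3, h4, h5⟩)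
    · have := h1 h4
      exact .inl ⟨h3, h4, by omega⟩
    · have := h2 h4
      exact .inr ⟨h3, h4, by omega⟩

theorem HasDiag.card_eq (h : HasDiag μ d) :
    μ.card = (frobeniusRows μ d).1.sum + (frobeniusRows μ d).2.sum + d := by
  have h1 : (μ.cells.filter fun c => c.1 ≤ c.2).card =
      ∑ i ∈ Finset.range d, (μ.rowLen i - (i + 1) + 1) := by
    rw [Finset.card_eq_sum_card_fiberwise (f := Prod.fst) (t := Finset.range d)]
    · refine Finset.sum_congr rfl fun i hi => ?_
      have hi := h.lt_rowLen (Finset.mem_range.1 hi)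
      rw [show (μ.cells.filter fun c => c.1 ≤ c.2).filter (fun c => c.1 = i) =
        (Finset.Ico i (μ.rowLen i)).map ⟨fun j => (i, j), Prod.mk_right_injective i⟩ from ?_,
        Finset.card_map, Nat.card_Ico]
      · omega
      · ext ⟨a, b⟩
        simp only [Finset.mem_filter, YoungDiagram.mem_cells, YoungDiagram.mem_iff_lt_rowLen,
          Finset.mem_map, Finset.mem_Ico, Function.Embedding.coeFn_mk, Prod.mk.injEq]
        constructor
        · rintro ⟨⟨h1, h2⟩, rfl⟩
          exact ⟨b, ⟨h2, h1⟩, rfl, rfl⟩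
        · rintro ⟨b, ⟨h2, h1⟩, rfl, rfl⟩
          exact ⟨⟨h1, h2⟩, rfl⟩
    · rintro ⟨a, b⟩ hc
      have hc := Finset.mem_filter.1 (Finset.mem_coe.1 hc)
      exact Finset.mem_coe.2 (Finset.mem_range.2 ((h a).1 (μ.up_left_mem le_rfl hc.2 hc.1)))
  have h2 : (μ.cells.filter fun c => ¬ c.1 ≤ c.2).card =
      ∑ i ∈ Finset.range d, (μ.colLen i - (i + 1)) := by
    rw [Finset.card_eq_sum_card_fiberwise (f := Prod.snd) (t := Finset.range d)]
    · refine Finset.sum_congr rfl fun j hj => ?_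
      rw [show (μ.cells.filter fun c => ¬ c.1 ≤ c.2).filter (fun c => c.2 = j) =
        (Finset.Ico (j + 1) (μ.colLen j)).map ⟨fun i => (i, j), Prod.mk_left_injective j⟩ from ?_,
        Finset.card_map, Nat.card_Ico]
      ext ⟨a, b⟩
      simp only [Finset.mem_filter, YoungDiagram.mem_cells, YoungDiagram.mem_iff_lt_colLen,
        Finset.mem_map, Finset.mem_Ico, Function.Embedding.coeFn_mk, Prod.mk.injEq, not_le]
      constructor
      · rintro ⟨⟨h1, h2⟩, rfl⟩
        exact ⟨a, ⟨h2, h1⟩, rfl, rfl⟩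
      · rintro ⟨a, ⟨h2, h1⟩, rfl, rfl⟩
        exact ⟨⟨h1, h2⟩, rfl⟩
    · rintro ⟨a, b⟩ hc
      have hc := Finset.mem_filter.1 (Finset.mem_coe.1 hc)
      exact Finset.mem_coe.2 (Finset.mem_range.2
        ((h b).1 (μ.up_left_mem (not_le.1 hc.2).le le_rfl hc.1)))
  rw [YoungDiagram.card, ← Finset.card_filter_add_card_filter_not (fun c => c.1 ≤ c.2), h1, h2,
    Finset.sum_add_distrib]
  simp only [frobeniusRows, Finset.sum_const, Finset.card_range, smul_eq_mul, mul_one]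
  have hs : ∀ f : ℕ → ℕ, ((List.range d).map f).sum = ∑ i ∈ Finset.range d, f i := fun _ => rfl
  rw [hs, hs]
  ring

/-- The drop of at least one per step is exactly what makes the diagram built from a symbol a lower
set. -/
theorem getD_add_sub_le {l : List ℕ} (hl : l.Pairwise (· > ·)) {i j : ℕ} (hij : i ≤ j)
    (hj : j < l.length) : l.getD j 0 + (j - i) ≤ l.getD i 0 := by
  induction j, hij using Nat.le_induction with
  | base => simp
  | succ j hij ih =>
    have h1 := ih (by omega)
    have h2 := List.pairwise_iff_getElem.1 hl j (j + 1) (by omega) hj (by omega)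
    rw [List.getD_eq_getElem _ _ hj]
    rw [List.getD_eq_getElem _ _ (by omega)] at h1
    omega

theorem exists_frobeniusRows_eq {p : List ℕ × List ℕ} (hp : p ∈ pairs d d) :
    ∃ μ : YoungDiagram, HasDiag μ d ∧ frobeniusRows μ d = p := by
  obtain ⟨xs, ys⟩ := p
  obtain ⟨hx, hy, hxd, hyd⟩ := hp
  simp only at hx hy hxd hyd
  have bx : ∀ i j, i ≤ j → j < d → xs.getD j 0 + (j - i) ≤ xs.getD i 0 :=
    fun i j h1 h2 => getD_add_sub_le hx h1 (by omega)
  have hby : ∀ i j, i ≤ j → j < d → ys.getD j 0 + (j - i) ≤ ys.getD i 0 :=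
    fun i j h1 h2 => getD_add_sub_le hy h1 (by omega)
  -- Entries become values of plain functions, so that `omega` sees them as atoms.
  generalize hX : (fun i => xs.getD i 0) = x at *
  generalize hY : (fun i => ys.getD i 0) = y at *
  have hX' : ∀ i, xs.getD i 0 = x i := fun i => congrFun hX i
  have hY' : ∀ i, ys.getD i 0 = y i := fun i => congrFun hY i
  simp only [hX', hY'] at bx hby
  let P : ℕ × ℕ → Prop := fun c => (c.1 ≤ c.2 ∧ c.1 < d ∧ c.2 ≤ c.1 + x c.1) ∨
    (c.2 < c.1 ∧ c.2 < d ∧ c.1 ≤ c.2 + y c.2)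
  -- The cells lie in a finite box, since `x 0` and `y 0` are the largest entries.
  have hP : ∀ c, P c → c.1 < d + x 0 + y 0 ∧ c.2 < d + x 0 + y 0 := by
    rintro ⟨i, j⟩ (⟨h1, h2, h3⟩ | ⟨h1, h2, h3⟩)
    · have := bx 0 i (by omega) h2
      simp only at h1 h2 h3 ⊢
      omega
    · have := hby 0 j (by omega) h2
      simp only at h1 h2 h3 ⊢
      omega
  let μ : YoungDiagram :=
    { cells := {c ∈ Finset.range (d + x 0 + y 0) ×ˢ Finset.range (d + x 0 + y 0) | P c}
      isLowerSet := by
        rintro ⟨i, j⟩ ⟨i', j'⟩ ⟨hi, hj⟩ hc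
        have hc := (Finset.mem_filter.1 (Finset.mem_coe.1 hc)).2
        suffices h : P (i', j') by
          refine Finset.mem_coe.2 (Finset.mem_filter.2 ⟨?_, h⟩)
          exact Finset.mem_product.2
            ⟨Finset.mem_range.2 (hP _ h).1, Finset.mem_range.2 (hP _ h).2⟩
        simp only [P] at hc hi hj ⊢
        rcases hc with ⟨h1, h2, h3⟩ | ⟨h1, h2, h3⟩
        · rcases le_or_gt i' j' with h | h
          · have := bx i' i hi h2
            omega
          · have := hby j' i (by omega) h2
            omega
        · rcases le_or_gt i' j' with h | h
          · have := bx i' j (by omega) h2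
            omega
          · have := hby j' j hj h2
            omega }
  have hμ : ∀ i j, (i, j) ∈ μ ↔ P (i, j) := by
    intro i j
    rw [← YoungDiagram.mem_cells]
    refine Finset.mem_filter.trans ⟨fun h => h.2, fun h => ⟨?_, h⟩⟩
    exact Finset.mem_product.2 ⟨Finset.mem_range.2 (hP _ h).1, Finset.mem_range.2 (hP _ h).2⟩
  have hr : ∀ i, i < d → μ.rowLen i = i + x i + 1 := by
    intro i hi
    refine eq_of_forall_lt_iff fun j => ?_
    rw [← YoungDiagram.mem_iff_lt_rowLen, hμ]
    rcases le_or_gt i j with h | h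
    · simp only [P]; omega
    · have := hby j i h.le hi
      simp only [P]; omega
  have hc : ∀ j, j < d → μ.colLen j = j + y j + 1 := by
    intro j hj
    refine eq_of_forall_lt_iff fun i => ?_
    rw [← YoungDiagram.mem_iff_lt_colLen, hμ]
    rcases le_or_gt i j with h | h
    · have := bx i j h hj
      simp only [P]; omega
    · simp only [P]; omega
  refine ⟨μ, fun i => ?_, ?_⟩
  · rw [hμ]
    simp only [P]; omega
  · refine Prod.ext (List.ext_getElem (by simp [frobeniusRows, hxd]) fun i h1 h2 => ?_)
      (List.ext_getElem (by simp [frobeniusRows, hyd]) fun i h1 h2 => ?_)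
    · simp only at h2
      have := hX' i
      rw [List.getD_eq_getElem _ _ h2] at this
      simp only [frobeniusRows, List.getElem_map, List.getElem_range, hr i (by omega), this]
      omega
    · simp only at h2
      have := hY' i
      rw [List.getD_eq_getElem _ _ h2] at this
      simp only [frobeniusRows, List.getElem_map, List.getElem_range, hc i (by omega), this]
      omega

/-! ### Partitions and Young diagrams -/

theorem card_cellsOfRowLens (w : List ℕ) : (YoungDiagram.cellsOfRowLens w).card = w.sum := by
  induction w with
  | nil => rfl
  | cons a w ih =>
    rw [YoungDiagram.cellsOfRowLens, Finset.card_union_of_disjoint, Finset.card_product,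
      Finset.card_map, ih]
    · simp
    · rw [Finset.disjoint_left]
      rintro ⟨i, j⟩ h1 h2
      obtain ⟨⟨i', j'⟩, -, h⟩ := Finset.mem_map.1 h2
      have h1 := (Finset.mem_product.1 h1).1
      simp only [Finset.mem_singleton] at h1
      simp only [Function.Embedding.coe_prodMap, Prod.map, Prod.mk.injEq] at h
      exact absurd (h.1.trans h1) (Nat.succ_ne_zero i')

/-- In a weakly decreasing list the entries above `j` form an initial segment. This identifies
`colLength` with the column length of the diagram. -/
theorem lt_countP_iff {w : List ℕ} (hw : w.Pairwise (· ≥ ·)) (i j : ℕ) :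
    i < w.countP (fun k => j < k) ↔ j < w.getD i 0 := by
  induction w generalizing i with
  | nil => simp
  | cons a w ih =>
    obtain ⟨h1, h2⟩ := List.pairwise_cons.1 hw
    rw [List.countP_cons]
    by_cases h : j < a
    · cases i with
      | zero => simp [h]
      | succ i =>
        rw [List.getD_cons_succ, ← ih h2 i]
        simp [h]
    · have : w.countP (fun k => j < k) = 0 := by
        rw [List.countP_eq_zero]
        intro b hb
        have := h1 b hb
        simp only [decide_eq_true_eq]
        omega
      cases i with
      | zero => simp [h, this]
      | succ i =>
        have h3 := ih h2 i
        rw [this] at h3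
        simp only [Nat.not_lt_zero, false_iff] at h3
        simp [h, this] at h3 ⊢
        exact h3

variable {n : ℕ}

/-- The Ferrers graph of a partition, as a Young diagram. -/
def diagram (p : n.Partition) : YoungDiagram :=
  .ofRowLens (p.parts.sort (· ≥ ·)) (p.parts.pairwise_sort (· ≥ ·)).sortedGE

theorem mem_diagram (p : n.Partition) (i j : ℕ) : (i, j) ∈ diagram p ↔ j < rowLength p i := by
  rw [diagram, YoungDiagram.mem_ofRowLens, rowLength]
  constructor
  · rintro ⟨h, h'⟩
    rwa [List.getD_eq_getElem _ _ h]
  · intro h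
    by_cases hi : i < (p.parts.sort (· ≥ ·)).length
    · rw [List.getD_eq_getElem _ _ hi] at h
      exact ⟨hi, h⟩
    · rw [List.getD_eq_default _ _ (not_lt.1 hi)] at h
      omega

theorem rowLen_diagram (p : n.Partition) (i : ℕ) : (diagram p).rowLen i = rowLength p i :=
  eq_of_forall_lt_iff fun j => by rw [← YoungDiagram.mem_iff_lt_rowLen, mem_diagram]

theorem colLen_diagram (p : n.Partition) (j : ℕ) : (diagram p).colLen j = colLength p j := by
  refine eq_of_forall_lt_iff fun i => ?_
  rw [← YoungDiagram.mem_iff_lt_colLen, mem_diagram, rowLength,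
    ← lt_countP_iff (p.parts.pairwise_sort (· ≥ ·)), colLength]
  conv_rhs => rw [← p.parts.sort_eq (· ≥ ·), Multiset.coe_countP]

theorem card_diagram (p : n.Partition) : (diagram p).card = n := by
  refine (card_cellsOfRowLens _).trans ?_
  rw [← Multiset.sum_coe, Multiset.sort_eq, p.parts_sum]

theorem diagram_injective : Function.Injective (diagram (n := n)) := by
  intro p q h
  have key : ∀ p : n.Partition, ((diagram p).rowLens : Multiset ℕ) = p.parts := by
    intro p
    rw [diagram, YoungDiagram.rowLens_ofRowLens_eq_self, Multiset.sort_eq]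
    exact fun x hx => p.parts_pos ((Multiset.mem_sort _).1 hx)
  exact Nat.Partition.ext (by rw [← key p, ← key q, h])

theorem exists_diagram_eq {μ : YoungDiagram} (h : μ.card = n) :
    ∃ p : n.Partition, diagram p = μ := by
  refine ⟨⟨μ.rowLens, fun hi => μ.pos_of_mem_rowLens _ (Multiset.mem_coe.1 hi), ?_⟩, ?_⟩
  · rw [Multiset.sum_coe, ← card_cellsOfRowLens, ← h]
    exact congrArg YoungDiagram.card (YoungDiagram.ofRowLens_to_rowLens_eq_self (μ := μ))
  · refine Eq.trans ?_ (YoungDiagram.ofRowLens_to_rowLens_eq_self (μ := μ))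
    simp only [diagram]
    congr 1
    rw [Multiset.coe_sort]
    exact List.mergeSort_of_pairwise (by simpa using! μ.rowLens_sorted.pairwise)

theorem hasDiag_diagram (p : n.Partition) : HasDiag (diagram p) (diagLength p) := by
  have hn : ∀ i, (i, i) ∈ diagram p → i < n := by
    intro i h
    have h1 := YoungDiagram.mem_iff_lt_rowLen.1 h
    rw [YoungDiagram.rowLen_eq_card] at h1
    exact h1.trans_le ((Finset.card_le_card (Finset.filter_subset _ _)).trans_eq (card_diagram p))
  -- The diagonal cells form an initial segment, whose length is the first missing index.
  have hex : ∃ i, (i, i) ∉ diagram p := ⟨n, fun h => lt_irrefl n (hn n h)⟩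
  have key : ∀ i, (i, i) ∈ diagram p ↔ i < Nat.find hex := by
    intro i
    refine ⟨fun h => ?_, fun h => not_not.1 (Nat.find_min hex h)⟩
    by_contra hi
    exact Nat.find_spec hex ((diagram p).up_left_mem (not_lt.1 hi) (not_lt.1 hi) h)
  have hd : diagLength p = Nat.find hex := by
    rw [diagLength, ← Finset.card_range (Nat.find hex)]
    congr 1
    ext i
    rw [Finset.mem_filter, Finset.mem_range, Finset.mem_range, ← key, ← mem_diagram]
    exact ⟨fun h => h.2, fun h => ⟨hn i h, h⟩⟩
  rw [hd]
  exact key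

theorem HasDiag.unique {μ : YoungDiagram} {d e : ℕ} (hd : HasDiag μ d) (he : HasDiag μ e) :
    d = e :=
  eq_of_forall_lt_iff fun i => (hd i).symm.trans (he i)

/-! ### From partitions to generating functions -/

/-- A column `(x, y)` of a Frobenius symbol is positive, as a Boolean. -/
def colSign (c : ℕ × ℕ) : Bool := decide (c.2 < c.1)

theorem signs_frobeniusRows (p : n.Partition) :
    signs (frobeniusRows (diagram p) (diagLength p)).1 (frobeniusRows (diagram p) (diagLength p)).2
      = (frobenius p).map colSign := by
  rw [signs_eq_map_zip (by simp [frobeniusRows]), frobeniusRows, frobenius, List.zip_map']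
  simp only [rowLen_diagram, colLen_diagram]
  rfl

theorem decide_sameParity (c c' : ℕ × ℕ) :
    decide (SameParity c c') = decide (colSign c = colSign c') := by
  simp only [SameParity, IsPositive, IsNegative, colSign, decide_eq_decide]
  omega

theorem length_parityBlocks (p : n.Partition) :
    (parityBlocks p).length = runs ((frobenius p).map colSign) :=
  length_splitBy _ _ decide_sameParity _

theorem lastBlockPositive_iff (p : n.Partition) :
    LastBlockPositive p ↔ ((frobenius p).map colSign).getLast? = some true := by
  rw [← getLast_splitBy _ _ decide_sameParity true]
  have h : ∀ c : ℕ × ℕ, IsPositive c ↔ colSign c = true := by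
    intro c
    simp only [IsPositive, colSign, decide_eq_true_eq]
    omega
  simp only [LastBlockPositive, h]
  rfl

theorem lastBlockNegative_iff (p : n.Partition) :
    LastBlockNegative p ↔ ((frobenius p).map colSign).getLast? = some false := by
  rw [← getLast_splitBy _ _ decide_sameParity false]
  have h : ∀ c : ℕ × ℕ, IsNegative c ↔ colSign c = false := by
    intro c
    simp only [IsNegative, colSign, decide_eq_false_iff_not]
    omega
  simp only [LastBlockNegative, h]
  rfl

/-- Partition to diagram to rows is a bijection onto the pairs; the summand `d` accounts for the
diagonal dots. -/
theorem card_partitions_eq (d : ℕ) (Q : List Bool → Prop) (S : Finset n.Partition)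
    (hS : ∀ p, p ∈ S ↔ (frobenius p).length = d ∧ Q ((frobenius p).map colSign)) :
    S.card = {p ∈ pairsWith d d Q | p.1.sum + p.2.sum + d = n}.ncard := by
  have hlen : ∀ p : n.Partition, (frobenius p).length = diagLength p := by simp [frobenius]
  rw [← Set.ncard_coe_finset S,
    ← Set.InjOn.ncard_image (f := fun p : n.Partition => frobeniusRows (diagram p) d)]
  · congr 1
    ext q
    constructor
    · rintro ⟨p, hp, rfl⟩
      obtain ⟨h1, h2⟩ := (hS p).1 hp
      rw [hlen] at h1
      subst h1
      have h := hasDiag_diagram p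
      refine ⟨⟨h.frobeniusRows_mem, ?_⟩, ?_⟩
      · rwa [signs_frobeniusRows]
      · rw [← h.card_eq, card_diagram]
    · rintro ⟨⟨h1, h2⟩, h3⟩
      obtain ⟨μ, hμ, rfl⟩ := exists_frobeniusRows_eq h1
      obtain ⟨p, rfl⟩ := exists_diagram_eq (hμ.card_eq.trans h3)
      obtain rfl := hμ.unique (hasDiag_diagram p)
      refine ⟨p, Finset.mem_coe.2 ((hS p).2 ⟨hlen p, ?_⟩), rfl⟩
      rwa [signs_frobeniusRows] at h2
  · intro p hp q hq h
    have hp' := hasDiag_diagram p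
    have hq' := hasDiag_diagram q
    rw [← hlen, ((hS _).1 hp).1] at hp'
    rw [← hlen, ((hS _).1 hq).1] at hq'
    exact diagram_injective (eq_of_frobeniusRows_eq hp' hq' h)

theorem mk_card_partitions_eq (d : ℕ) (Q : List Bool → Prop) (S : ∀ n : ℕ, Finset n.Partition)
    (hS : ∀ n p, p ∈ S n ↔ (frobenius p).length = d ∧ Q ((frobenius p).map colSign)) :
    PowerSeries.mk (fun n => ((S n).card : ℚ)) = X ^ d * genFun (pairsWith d d Q) := by
  ext n
  rw [coeff_X_pow_mul', coeff_mk, card_partitions_eq d Q (S n) (hS n), genFun, coeff_mk]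
  split_ifs with h
  · congr 3
    ext p
    exact and_congr_right fun _ => by omega
  · rw [show {p ∈ pairsWith d d Q | p.1.sum + p.2.sum + d = n} = ∅ from
      Set.eq_empty_iff_forall_notMem.2 fun p hp => h (by have := hp.2; omega)]
    simp

theorem mk_aPos_eq (d k : ℕ) : PowerSeries.mk (fun n => (aPos (k + 1) d n : ℚ)) =
    X ^ d * (lastGen true k d - lastGen true (k + 1) d) := by
  rw [← genFun_runs_eq]
  refine mk_card_partitions_eq d _ _ fun n p => ?_
  rw [Finset.mem_filter, length_parityBlocks, lastBlockPositive_iff]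
  simp

theorem mk_aNeg_eq (d k : ℕ) : PowerSeries.mk (fun n => (aNeg (k + 1) d n : ℚ)) =
    X ^ d * (lastGen false k d - lastGen false (k + 1) d) := by
  rw [← genFun_runs_eq]
  refine mk_card_partitions_eq d _ _ fun n p => ?_
  rw [Finset.mem_filter, length_parityBlocks, lastBlockNegative_iff]
  simp

theorem inv_mul_qBinomial {n k : ℕ} (h : k ≤ n) :
    (qPochhammer (X : ℚ⟦X⟧) X n)⁻¹ * qBinomial n k = invPoch k * invPoch (n - k) := by
  rw [qBinomial, if_pos h, PowerSeries.mul_inv_rev, ← invPoch, ← invPoch, ← invPoch]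
  linear_combination invPoch k * invPoch (n - k) * invPoch_mul n

end ParityBlocks

theorem theorem1p1 (d m : ℕ) (hm : 1 ≤ m) (hmd : m ≤ d) :
    (PowerSeries.mk (fun n => (ParityBlocks.aPos m d n : ℚ)) =
      (PowerSeries.X : PowerSeries ℚ) ^ (d ^ 2 + d + m.choose 2) *
        (ParityBlocks.qPochhammer PowerSeries.X PowerSeries.X (2 * d))⁻¹ *
        ((1 - PowerSeries.X ^ m) * (1 - PowerSeries.X ^ d)⁻¹) *
        ParityBlocks.qBinomial (2 * d) (d + m)) ∧
    (PowerSeries.mk (fun n => (ParityBlocks.aNeg m d n : ℚ)) =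
      (PowerSeries.X : PowerSeries ℚ) ^ (d ^ 2 + m.choose 2) *
        (ParityBlocks.qPochhammer PowerSeries.X PowerSeries.X (2 * d))⁻¹ *
        ((1 - PowerSeries.X ^ m) * (1 - PowerSeries.X ^ d)⁻¹) *
        ParityBlocks.qBinomial (2 * d) (d + m)) := by
  -- With `m = k + 1` and `d = a + 1`, exactly `m` runs means more than `k` but not more than `k +
  -- 1`.
  obtain ⟨k, rfl⟩ := Nat.exists_eq_add_of_le' hm
  obtain ⟨a, rfl⟩ := Nat.exists_eq_add_of_le' (hm.trans hmd)
  have hq := ParityBlocks.inv_mul_qBinomial (n := 2 * (a + 1)) (k := a + 1 + (k + 1)) (by omega)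
  rw [show 2 * (a + 1) - (a + 1 + (k + 1)) = a - k by omega] at hq
  rw [ParityBlocks.mk_aPos_eq, ParityBlocks.mk_aNeg_eq,
    ParityBlocks.X_pow_mul_lastGen_true (by omega), ParityBlocks.X_pow_mul_lastGen_false (by omega),
    ← hq]
  constructor <;> ring
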